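/- All logarithms are to base $2$. A monotonic distribution is a probability vector $\theta=(\theta_1,\theta_2,\dots)$ on the positive integers with $\theta_1\ge\theta_2\ge\cdots\ge 0$; its entropy is $H_\theta(X)=-\sum_i\theta_i\log\theta_i$. A code for length $n$ is a binary prefix code for the sequences in $\{1,2,\dots\}^n$, with length function $L_n$; its (per-symbol) redundancy for $\theta$ is $$R_n(L_n,\theta)=\tfrac1n E_\theta L_n(X^n)-H_\theta(X),$$ where $X^n$ is i.i.d. with distribution $\theta$. For a sequence $m=m(n)$ of real effective alphabet sizes put $\rho=\rho(n)=\log m(n)/\log n$, and, for $\varepsilon>0$, $$\mathcal R_n(m)=\begin{cases}\dfrac{m-1}{2}\log\dfrac{n}{m^3}, & \text{if } m=o(n^{1/3}),\\[2mm] \dfrac12\left(\rho+\dfrac23\right)\left(\rho+\varepsilon-\dfrac13\right)(\log n)^2\,n^{1/3}, & \text{otherwise.}\end{cases}$$ I. For every $\varepsilon>0$ there is a sequence of codes $L^*=(L^*_n)$, depending on $\varepsilon$ only, with the following property. Let $\theta=\theta^{(n)}$ be monotonic distributions (fixed, or varying with $n$), and let $m^*=m^*(n)$ satisfy $m^*>n^{\varepsilon}$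 for all large $n$ and either $m^*=o(n^{1/3})$ or $n^{1/3}=O(m^*)$. If, the sums being finite for all large $n$, $$\sum_{i>m^*} n\,\theta_i\log i=o\big(\mathcal R_n(m^*)\big)\qquad(n\to\infty),$$ then for all sufficiently large $n$ the expected code length and the entropy are finite and $$R_n(L^*_n,\theta)\le\frac{1+\varepsilon}{n}\,\mathcal R_n(m^*).$$ II. There is a (universal) sequence of codes $L^*=(L^*_n)$ with the following property. Let $\theta=\theta^{(n)}$ be monotonic distributions (fixed, or varying with $n$), and let $m^*=m^*(n)\ge 1$ for all large $n$ be such that $\rho^*=\log m^*/\log n=o\big(n^{1/3}/\log n\big)$ and, the sums being finite for all large $n$, $$\sum_{i>m^*}\theta_i\log i=o(1).$$ Then the expected code length and the entropy are finite for all large $n$, and $R_n(L^*_n,\theta)=o(1)$. -/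

import Mathlib

open Filter Asymptotics

/-- A monotonic probability distribution on the alphabet of positive integers
(finite alphabets are included: the probabilities may vanish from some point on). -/
structure MonotonicDist where
  prob : ℕ+ → ℝ
  nonneg : ∀ i, 0 ≤ prob i
  hasSum_one : HasSum prob 1
  antitone : Antitone prob

/-- The i.i.d. probability of the sequence `x` of length `n`. -/
noncomputable def MonotonicDist.seqProb (θ : MonotonicDist) {n : ℕ} (x : Fin n → ℕ+) : ℝ :=
  ∏ j, θ.prob (x j)

/-- The summands of the entropy in bits. -/
noncomputable def MonotonicDist.entropyTerm (θ : MonotonicDist) (i : ℕ+) : ℝ :=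
  -(θ.prob i * Real.logb 2 (θ.prob i))

/-- The per-symbol entropy in bits. -/
noncomputable def MonotonicDist.entropy (θ : MonotonicDist) : ℝ :=
  ∑' i, θ.entropyTerm i

/-- A binary prefix code for sequences of length `n` over the positive integers. -/
structure BlockCode (n : ℕ) where
  encode : (Fin n → ℕ+) → List Bool
  prefix_free : ∀ x y, encode x <+: encode y → x = y

/-- The length function of a code, in bits. -/
def BlockCode.len {n : ℕ} (C : BlockCode n) (x : Fin n → ℕ+) : ℕ :=
  (C.encode x).length

/-- The summands of the expected code length. -/
noncomputable def BlockCode.expTerm {n : ℕ} (C : BlockCode n) (θ : MonotonicDist)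
    (x : Fin n → ℕ+) : ℝ :=
  θ.seqProb x * (C.len x : ℝ)

/-- The entropy and the expected code length are both finite,
so that the redundancy is well defined. -/
def FiniteRedundancy {n : ℕ} (C : BlockCode n) (θ : MonotonicDist) : Prop :=
  Summable (C.expTerm θ) ∧ Summable θ.entropyTerm

/-- The per-symbol redundancy `(1 / n) E L(Xⁿ) - H(X)`. -/
noncomputable def redundancy {n : ℕ} (C : BlockCode n) (θ : MonotonicDist) : ℝ :=
  (1 / (n : ℝ)) * (∑' x, C.expTerm θ x) - θ.entropy

/-- The summands of `∑_{i > m} θ_i log₂ i`. -/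
noncomputable def MonotonicDist.tailTerm (θ : MonotonicDist) (m : ℝ) (i : ℕ+) : ℝ :=
  if m < ((i : ℕ) : ℝ) then θ.prob i * Real.logb 2 ((i : ℕ) : ℝ) else 0

/-- The tail cost `∑_{i > m} θ_i log₂ i`. -/
noncomputable def MonotonicDist.tailCost (θ : MonotonicDist) (m : ℝ) : ℝ :=
  ∑' i, θ.tailTerm m i

/-- The exponent `ρ` for which `m = n ^ ρ`. -/
noncomputable def effExponent (m : ℝ) (n : ℕ) : ℝ :=
  Real.logb 2 m / Real.logb 2 (n : ℝ)

/-- The effective alphabet size `m = m(n)` is `o(n^{1/3})`. -/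
def SmallAlphabet (m : ℕ → ℝ) : Prop :=
  m =o[atTop] fun n : ℕ => (n : ℝ) ^ ((1 : ℝ) / 3)

/-- The effective alphabet size `m = m(n)` is at least of order `n^{1/3}`. -/
def LargeAlphabet (m : ℕ → ℝ) : Prop :=
  (fun n : ℕ => (n : ℝ) ^ ((1 : ℝ) / 3)) =O[atTop] m

open Classical in
/-- The block cost associated with the effective alphabet size `m = m(n)`; the choice
between the two expressions depends on the growth of the sequence `m`. -/
noncomputable def blockCost (ε : ℝ) (m : ℕ → ℝ) (n : ℕ) : ℝ :=
  if SmallAlphabet m then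
    (m n - 1) / 2 * Real.logb 2 ((n : ℝ) / m n ^ 3)
  else
    1 / 2 * (effExponent (m n) n + 2 / 3) * (effExponent (m n) n + ε - 1 / 3)
      * Real.logb 2 (n : ℝ) ^ 2 * (n : ℝ) ^ ((1 : ℝ) / 3)

/-! ### Sums over sequences -/

/-! A single code serves both parts and every `ε`: the Shannon–Fano–Elias code of a countable
mixture of memoryless sources. The mixture dominates each weighted component, so a component `φ` of
weight `w` bounds the block redundancy by `2 - log w + n D(θ‖φ)`. It remains to find, for each `θ`
and `m`, a component of large weight close to `θ` on its first `k = ⌊m⌋` symbols.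

Each component is smoothed by `1/n` of a heavy-tailed source. This costs a constant per block and
makes a symbol `i > m` cost at most `(K + 3) log i` when `log n ≤ K log m`, hence the tail term. On
the main symbols the divergence is bounded by a chi-square distance (`smoothed_cost_le`).

Two families of components are used. For small alphabets (`exists_decrementSource`), round `√(n
θ_j)` down to an integer `u_j` and use `(1 + u_j)² / n`: the chi-square error is `O(1/n)` per
symbol. Since `u` decreases and `u_j ≤ √(n/j)`, its decrements are cheaply described by geometric
laws of scale `√(n/j³)`, at total cost `(k/2) log (n/k³) + O(k)`. This is the main term of the block
cost.

For large alphabets (`exists_levelSource`), round `θ_j` to powers of `exp (-δ)`. By monotonicity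
only the jump positions need describing: about `log (kn) / δ` positions at `log (k+1)` bits each,
against a divergence `O(n δ²)`. With `δ = √(log n) / n^{1/3}` both terms are `O((log m + log n)²
n^{1/3} / √(log n))`, negligible against the block cost, and `o(n)` in Part II.

Part II also needs a lower bound on the redundancy, which follows from Kraft's inequality
(`redundancy_nonneg`). -/

theorem hasSum_pi_prod {α : Type*} {n : ℕ} {f : Fin n → α → ℝ} {F : Fin n → ℝ}
    (hf : ∀ j a, 0 ≤ f j a) (h : ∀ j, HasSum (f j) (F j)) :
    HasSum (fun x : Fin n → α => ∏ j, f j (x j)) (∏ j, F j) := by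
  induction n with
  | zero => simp
  | succ n ih =>
    have ih' := ih (f := fun j => f j.succ) (F := fun j => F j.succ)
      (fun j a => hf _ a) (fun j => h _)
    have hs := Summable.mul_of_nonneg (h 0).summable ih'.summable (fun a => hf 0 a)
      (fun x => Finset.prod_nonneg fun j _ => hf _ _)
    have := (h 0).mul ih' hs
    rw [← (Fin.consEquiv (fun _ : Fin (n + 1) => α)).hasSum_iff, Fin.prod_univ_succ]
    refine this.congr_fun ?_
    intro p
    simp [Fin.consEquiv, Fin.prod_univ_succ]

theorem hasSum_pi_prod_mul_sum {α : Type*} (n : ℕ) {p g : α → ℝ} {G : ℝ}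
    (hp : ∀ a, 0 ≤ p a) (hg : ∀ a, 0 ≤ g a) (h1 : HasSum p 1)
    (hG : HasSum (fun a => p a * g a) G) :
    HasSum (fun x : Fin n → α => (∏ j, p (x j)) * ∑ j, g (x j)) (n * G) := by
  have key : ∀ j : Fin n,
      HasSum (fun x : Fin n → α => (∏ l, p (x l)) * g (x j)) G := by
    intro j
    -- The factor `g` is put into coordinate `j` alone, so the sum still factorizes.
    have := hasSum_pi_prod (n := n) (f := fun l a => p a * (if l = j then g a else 1))
      (F := fun l => if l = j then G else 1)
      (fun l a => mul_nonneg (hp a) (by split_ifs <;> simp [hg a]))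
      (fun l => by split_ifs <;> simpa)
    simpa only [Finset.prod_mul_distrib, Finset.prod_ite_eq', Finset.mem_univ, if_true] using this
  have := hasSum_sum (s := Finset.univ) (fun j (_ : j ∈ Finset.univ) => key j)
  simpa [Finset.mul_sum] using this

/-! ### Shannon–Fano–Elias coding -/

/-- The binary digit of weight `2⁻⁽ʲ⁺¹⁾` of a real number. -/
noncomputable def binaryDigit (r : ℝ) (j : ℕ) : Bool :=
  decide (⌊(2 : ℝ) ^ (j + 1) * r⌋₊ % 2 = 1)

/-- Halving the floor at precision `l + 1` gives the floor at precision `l`, and the next digit is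
its parity. Being below one fixes the start of the induction. -/
theorem floor_eq_of_binaryDigit_eq {r s : ℝ} (hr : r < 1) (hs : s < 1) (l : ℕ)
    (h : ∀ j < l, binaryDigit r j = binaryDigit s j) :
    ⌊(2 : ℝ) ^ l * r⌋₊ = ⌊(2 : ℝ) ^ l * s⌋₊ := by
  induction l with
  | zero =>
    simp [Nat.floor_eq_zero.2 hr, Nat.floor_eq_zero.2 hs]
  | succ l ih =>
    have e := ih fun j hj => h j (by omega)
    have half : ∀ t : ℝ, ⌊(2 : ℝ) ^ l * t⌋₊ = ⌊(2 : ℝ) ^ (l + 1) * t⌋₊ / 2 := by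
      intro t
      have := Nat.floor_div_natCast ((2 : ℝ) ^ (l + 1) * t) 2
      rw [← this]
      congr 1
      push_cast
      ring
    rw [half r, half s] at e
    have hb := h l (by omega)
    simp only [binaryDigit, decide_eq_decide] at hb
    omega

/-- Codewords are truncated binary expansions of the midpoints of the cumulative intervals, the
alphabet being ordered by an injection into `ℕ`. A prefix relation would force two midpoints closer
than `P x / 2`, but disjoint intervals keep them at least that far apart. -/
theorem exists_prefix_free_encoding {α : Type*} [Countable α] {P : α → ℝ} (hP : ∀ x, 0 < P x)
    (hs : Summable P) (h1 : ∑' x, P x ≤ 1) :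
    ∃ c : α → List Bool, (∀ x y, c x <+: c y → x = y) ∧
      (∀ x, (1 / 2 : ℝ) ^ (c x).length ≤ P x) ∧
      ∀ x, ((c x).length : ℝ) ≤ 2 - Real.logb 2 (P x) := by
  obtain ⟨e, he⟩ := exists_injective_nat α
  classical
  set F : α → ℝ := fun x => ∑' z, if e z < e x then P z else 0 with hF
  have sF : ∀ x, Summable fun z => if e z < e x then P z else 0 := fun x =>
    hs.of_nonneg_of_le (fun z => by split_ifs; exacts [(hP z).le, le_rfl])
      (fun z => by split_ifs; exacts [le_rfl, (hP z).le])
  have F0 : ∀ x, 0 ≤ F x := fun x => tsum_nonneg fun z => by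
    split_ifs; exacts [(hP z).le, le_rfl]
  have FP : ∀ x, HasSum (fun z => (if e z < e x then P z else 0) + if z = x then P x else 0)
      (F x + P x) := fun x => (sF x).hasSum.add (hasSum_ite_eq x (P x))
  have F1 : ∀ x, F x + P x ≤ 1 := by
    intro x
    refine le_trans (hasSum_le ?_ (FP x) hs.hasSum) h1
    intro z
    by_cases hz : z = x
    · subst hz; simp
    · simp only [hz, if_false, add_zero]; split_ifs; exacts [le_rfl, (hP z).le]
  have Flt : ∀ x y, e x < e y → F x + P x ≤ F y := by
    intro x y hxy
    refine hasSum_le ?_ (FP x) (sF y).hasSum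
    intro z
    by_cases hz : z = x
    · subst hz; simp [hxy]
    · simp only [hz, if_false, add_zero]
      by_cases h : e z < e x
      · simp [h, h.trans hxy]
      · simp only [h, if_false]; split_ifs; exacts [(hP z).le, le_rfl]
  -- The extra digit brings the truncation error down to half the interval, `P x / 2`.
  set L : α → ℕ := fun x => ⌈-Real.logb 2 (P x)⌉₊ + 1 with hL
  have hP1 : ∀ x, P x ≤ 1 := fun x => by linarith [F0 x, F1 x]
  have hlog : ∀ x, 0 ≤ -Real.logb 2 (P x) := fun x => by
    have := Real.logb_nonpos (b := 2) (by norm_num) (hP x).le (hP1 x)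
    linarith
  have hLP : ∀ x, (1 / 2 : ℝ) ^ L x ≤ P x / 2 := by
    intro x
    have h2 : -Real.logb 2 (P x) ≤ (⌈-Real.logb 2 (P x)⌉₊ : ℝ) := Nat.le_ceil _
    have : (2 : ℝ) ^ (-(⌈-Real.logb 2 (P x)⌉₊ : ℝ)) ≤ P x := by
      rw [← Real.le_logb_iff_rpow_le (by norm_num) (hP x)]
      linarith
    rw [Real.rpow_neg (by norm_num), Real.rpow_natCast] at this
    simp only [hL, pow_succ, one_div, inv_pow]
    linarith
  set r : α → ℝ := fun x => F x + P x / 2 with hr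
  have r1 : ∀ x, r x < 1 := fun x => by
    have := F1 x; have := hP x; simp only [hr]; linarith
  have r0 : ∀ x, 0 ≤ r x := fun x => by
    have := F0 x; have := hP x; simp only [hr]; linarith
  refine ⟨fun x => List.ofFn fun j : Fin (L x) => binaryDigit (r x) j, ?_, ?_, ?_⟩
  · intro x y hxy
    by_contra hne
    have hdig : ∀ j < L x, binaryDigit (r x) j = binaryDigit (r y) j := by
      intro j hj
      have hlen := hxy.length_le
      simp only [List.length_ofFn] at hlen
      have := hxy.getElem (i := j) (by simpa only [List.length_ofFn] using hj)
      simpa only [List.getElem_ofFn] using this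
    have hfl := floor_eq_of_binaryDigit_eq (r1 x) (r1 y) (L x) hdig
    have a1 := Nat.floor_le (a := (2 : ℝ) ^ L x * r x) (by have := r0 x; positivity)
    have a2 := Nat.lt_floor_add_one ((2 : ℝ) ^ L x * r x)
    have b1 := Nat.floor_le (a := (2 : ℝ) ^ L x * r y) (by have := r0 y; positivity)
    have b2 := Nat.lt_floor_add_one ((2 : ℝ) ^ L x * r y)
    rw [hfl] at a1 a2
    have h2 : (0 : ℝ) < 2 ^ L x := by positivity
    have hl := hLP x
    rw [one_div, inv_pow, inv_le_iff_one_le_mul₀ h2] at hl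
    have hPy := hP y
    have hen : e x ≠ e y := fun h => hne (he h)
    rcases lt_or_gt_of_ne hen with h | h
    · have hd : P x / 2 ≤ r y - r x := by
        have := Flt x y h; simp only [hr]; linarith
      nlinarith
    · have hd : P x / 2 ≤ r x - r y := by
        have := Flt y x h; simp only [hr]; linarith
      nlinarith
  · intro x
    simp only [List.length_ofFn]
    have := hLP x; have := hP x; linarith
  · intro x
    simp only [List.length_ofFn, hL]
    push_cast
    have := Nat.ceil_lt_add_one (hlog x)
    linarith

/-- The Kraft sum of a block code is at most one. -/
def BlockCode.KraftLe {n : ℕ} (C : BlockCode n) : Prop :=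
  Summable (fun x => (1 / 2 : ℝ) ^ C.len x) ∧ ∑' x, (1 / 2 : ℝ) ^ C.len x ≤ 1

/-- The mixture is pointwise at least each `w i * q i`, so coding for it is as good as knowing `i`
up to `-log (w i)` bits. -/
theorem exists_prefix_free_mixture_encoding {α ι : Type*} [Countable α] [Nonempty ι] {w : ι → ℝ}
    (hw : ∀ i, 0 < w i) (hws : Summable w) (hw1 : ∑' i, w i ≤ 1) {q : ι → α → ℝ}
    (hpos : ∀ i x, 0 < q i x) (hq : ∀ i, HasSum (q i) 1) :
    ∃ c : α → List Bool, (∀ x y, c x <+: c y → x = y) ∧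
      Summable (fun x => (1 / 2 : ℝ) ^ (c x).length) ∧
      ∑' x, (1 / 2 : ℝ) ^ (c x).length ≤ 1 ∧
      ∀ i x, ((c x).length : ℝ) ≤ 2 - Real.logb 2 (w i * q i x) := by
  have h1 : ∀ i, Summable fun x => w i * q i x := fun i =>
    Summable.mul_left (w i) (hq i).summable
  have hsum : Summable fun p : ι × α => w p.1 * q p.1 p.2 := by
    rw [summable_prod_of_nonneg (fun p => mul_nonneg (hw _).le (hpos _ _).le)]
    refine ⟨h1, ?_⟩
    have : (fun i => ∑' x, w i * q i x) = w := funext fun i => by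
      rw [tsum_mul_left, (hq i).tsum_eq, mul_one]
    rw [this]
    exact hws
  have hsum' : Summable fun p : α × ι => w p.2 * q p.2 p.1 := hsum.prod_symm
  set P : α → ℝ := fun x => ∑' i, w i * q i x with hP
  have hPi : ∀ i x, w i * q i x ≤ P x := fun i x =>
    (hsum'.prod_factor x).le_tsum i fun i' _ => mul_nonneg (hw _).le (hpos _ _).le
  have hPpos : ∀ x, 0 < P x := fun x =>
    lt_of_lt_of_le (mul_pos (hw (Classical.arbitrary ι)) (hpos _ x)) (hPi _ x)
  have hPs : Summable P := hsum'.prod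
  have hP1 : ∑' x, P x ≤ 1 := by
    have : ∑' x, P x = ∑' i, w i := by
      refine (Summable.tsum_comm (f := fun x i => w i * q i x) hsum').symm.trans
        (tsum_congr fun i => ?_)
      rw [tsum_mul_left, (hq i).tsum_eq, mul_one]
    rwa [this]
  obtain ⟨c, hc, hk, hl⟩ := exists_prefix_free_encoding hPpos hPs hP1
  have hks : Summable fun x => (1 / 2 : ℝ) ^ (c x).length :=
    hPs.of_nonneg_of_le (fun x => by positivity) hk
  refine ⟨c, hc, hks, (hks.tsum_le_tsum hk hPs).trans hP1, fun i x => (hl x).trans ?_⟩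
  have := Real.logb_le_logb_of_le (b := 2) (by norm_num) (mul_pos (hw i) (hpos i x)) (hPi i x)
  linarith

/-- A code for a mixture of memoryless sources. -/
theorem exists_mixture_code (n : ℕ) {ι : Type*} [Nonempty ι] {w : ι → ℝ} (hw : ∀ i, 0 < w i)
    (hws : Summable w) (hw1 : ∑' i, w i ≤ 1) {φ : ι → ℕ+ → ℝ} (hφ : ∀ i a, 0 < φ i a)
    (hφs : ∀ i, HasSum (φ i) 1) :
    ∃ C : BlockCode n, C.KraftLe ∧ ∀ i x,
      (C.len x : ℝ) ≤ 2 - Real.logb 2 (w i) + ∑ j, -Real.logb 2 (φ i (x j)) := by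
  have hpos : ∀ (i : ι) (x : Fin n → ℕ+), 0 < ∏ j, φ i (x j) := fun i x =>
    Finset.prod_pos fun j _ => hφ i _
  obtain ⟨c, hc, hks, hk1, hl⟩ := exists_prefix_free_mixture_encoding hw hws hw1 hpos
    fun i => by
      simpa using hasSum_pi_prod (n := n) (f := fun _ => φ i) (F := fun _ => 1)
        (fun _ a => (hφ i a).le) (fun _ => hφs i)
  refine ⟨⟨c, hc⟩, ⟨hks, hk1⟩, fun i x => (hl i x).trans (le_of_eq ?_)⟩
  rw [Real.logb_mul (hw i).ne' (hpos i x).ne', Real.logb_prod _ _ fun j _ => (hφ i _).ne',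
    Finset.sum_neg_distrib]
  ring

/-! ### Expected code length and redundancy -/

theorem inv_log_two_le : (Real.log 2)⁻¹ ≤ 2 := by
  rw [inv_le_comm₀ (Real.log_pos (by norm_num)) (by norm_num)]
  linarith [Real.log_two_gt_d9]

theorem MonotonicDist.prob_le_one (θ : MonotonicDist) (i : ℕ+) : θ.prob i ≤ 1 :=
  le_hasSum θ.hasSum_one i fun j _ => θ.nonneg j

theorem MonotonicDist.logb_prob_nonpos (θ : MonotonicDist) (i : ℕ+) :
    Real.logb 2 (θ.prob i) ≤ 0 :=
  Real.logb_nonpos (by norm_num) (θ.nonneg i) (θ.prob_le_one i)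

theorem MonotonicDist.entropyTerm_nonneg (θ : MonotonicDist) (i : ℕ+) : 0 ≤ θ.entropyTerm i := by
  have := mul_nonneg (θ.nonneg i) (neg_nonneg.2 (θ.logb_prob_nonpos i))
  simp only [MonotonicDist.entropyTerm]
  linarith

theorem MonotonicDist.seqProb_nonneg (θ : MonotonicDist) {n : ℕ} (x : Fin n → ℕ+) :
    0 ≤ θ.seqProb x :=
  Finset.prod_nonneg fun _ _ => θ.nonneg _

theorem MonotonicDist.hasSum_seqProb (θ : MonotonicDist) (n : ℕ) :
    HasSum (fun x : Fin n → ℕ+ => θ.seqProb x) 1 := by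
  simpa [MonotonicDist.seqProb] using hasSum_pi_prod (n := n) (f := fun _ => θ.prob)
    (F := fun _ => 1) (fun _ a => θ.nonneg a) (fun _ => θ.hasSum_one)

theorem MonotonicDist.hasSum_seqProb_mul_sum (θ : MonotonicDist) (n : ℕ) {g : ℕ+ → ℝ} {G : ℝ}
    (hg : ∀ i, 0 ≤ g i) (hG : HasSum (fun i => θ.prob i * g i) G) :
    HasSum (fun x : Fin n → ℕ+ => θ.seqProb x * ∑ j, g (x j)) (n * G) :=
  hasSum_pi_prod_mul_sum n θ.nonneg hg θ.hasSum_one hG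

/-- With `g = -log φ`, the difference `G - θ.entropy` is the divergence of `θ` from `φ`. -/
theorem summable_expTerm_and_redundancy_le {n : ℕ} (hn : 1 ≤ n) (C : BlockCode n)
    (θ : MonotonicDist) {c G : ℝ} {g : ℕ+ → ℝ} (hg : ∀ i, 0 ≤ g i)
    (hC : ∀ x, (C.len x : ℝ) ≤ c + ∑ j, g (x j))
    (hG : HasSum (fun i => θ.prob i * g i) G) :
    Summable (C.expTerm θ) ∧ n * redundancy C θ ≤ c + n * (G - θ.entropy) := by
  have h1 := ((θ.hasSum_seqProb n).mul_right c).add (θ.hasSum_seqProb_mul_sum n hg hG)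
  have hle : ∀ x, C.expTerm θ x ≤ θ.seqProb x * c + θ.seqProb x * ∑ j, g (x j) := fun x => by
    rw [BlockCode.expTerm, ← mul_add]
    exact mul_le_mul_of_nonneg_left (hC x) (θ.seqProb_nonneg x)
  have hs : Summable (C.expTerm θ) :=
    h1.summable.of_nonneg_of_le (fun x => mul_nonneg (θ.seqProb_nonneg x) (Nat.cast_nonneg _)) hle
  refine ⟨hs, ?_⟩
  have h2 := hasSum_le hle hs.hasSum h1
  have hn0 : (n : ℝ) ≠ 0 := by positivity
  rw [redundancy, mul_sub, one_div, mul_inv_cancel_left₀ hn0]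
  linarith

/-- Gibbs' inequality against the subprobability `2 ^ (-L)`: termwise `p L + p log p ≥ (p - 2 ^
(-L)) / ln 2`, and the right side has nonnegative sum by Kraft. -/
theorem redundancy_nonneg {n : ℕ} (hn : 1 ≤ n) {C : BlockCode n} (hC : C.KraftLe)
    {θ : MonotonicDist} (hf : FiniteRedundancy C θ) : 0 ≤ redundancy C θ := by
  have hH := θ.hasSum_seqProb_mul_sum n (g := fun i => -Real.logb 2 (θ.prob i))
    (G := θ.entropy) (fun i => neg_nonneg.2 (θ.logb_prob_nonpos i)) (by
      simp only [mul_neg]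
      exact hf.2.hasSum)
  have hd := hf.1.hasSum.sub hH
  have hq := ((θ.hasSum_seqProb n).sub hC.1.hasSum).mul_right (Real.log 2)⁻¹
  have hl2 : 0 < Real.log 2 := Real.log_pos (by norm_num)
  have hle := hasSum_le (fun x => ?_) hq hd
  · have h0 : 0 ≤ (1 - ∑' x, (1 / 2 : ℝ) ^ C.len x) * (Real.log 2)⁻¹ :=
      mul_nonneg (by linarith [hC.2]) (by positivity)
    have hn0 : (0 : ℝ) < n := by positivity
    have : 0 ≤ n * redundancy C θ := by
      rw [redundancy, mul_sub, one_div, mul_inv_cancel_left₀ hn0.ne']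
      linarith
    exact nonneg_of_mul_nonneg_right this hn0
  · rcases (θ.seqProb_nonneg x).eq_or_lt with h | h
    · simp only [BlockCode.expTerm, ← h, zero_mul, sub_zero, zero_sub]
      have : (0 : ℝ) < (1 / 2) ^ C.len x := by positivity
      have : 0 ≤ (1 / 2 : ℝ) ^ C.len x * (Real.log 2)⁻¹ := by positivity
      linarith
    · have hne : ∀ j ∈ Finset.univ, θ.prob (x j) ≠ 0 := by
        intro j hj h0
        rw [MonotonicDist.seqProb, Finset.prod_eq_zero hj h0] at h
        exact lt_irrefl _ h
      rw [BlockCode.expTerm, Finset.sum_neg_distrib, ← Real.logb_prod _ _ hne]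
      change _ ≤ _ - θ.seqProb x * -Real.logb 2 (θ.seqProb x)
      set p := θ.seqProb x
      set L := C.len x
      have hlog := Real.log_le_sub_one_of_pos (x := (1 / 2 : ℝ) ^ L / p) (by positivity)
      rw [Real.log_div (by positivity) h.ne', Real.log_pow, one_div, Real.log_inv] at hlog
      have h3 := mul_le_mul_of_nonneg_left hlog h.le
      rw [mul_sub p (_ / p), mul_div_cancel₀ _ h.ne'] at h3
      rw [← div_eq_mul_inv, div_le_iff₀ hl2, Real.logb, one_div]
      have : (p * (L : ℝ) - p * -(Real.log p / Real.log 2)) * Real.log 2 =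
          p * (L * Real.log 2) + p * Real.log p := by
        field_simp
        ring
      rw [this]
      linarith

/-! ### Smoothed memoryless sources -/

/-- A telescoping law used twice: as the heavy tail in the smoothing and as the prior on the number
of main symbols. -/
theorem hasSum_one_div_succ_mul_succ :
    HasSum (fun j : ℕ => 1 / (((j : ℝ) + 1) * ((j : ℝ) + 2))) 1 := by
  rw [hasSum_iff_tendsto_nat_of_nonneg (fun j => by positivity)]
  have : ∀ N : ℕ, ∑ j ∈ Finset.range N, 1 / (((j : ℝ) + 1) * ((j : ℝ) + 2)) =
      1 - 1 / ((N : ℝ) + 1) := by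
    intro N
    induction N with
    | zero => simp
    | succ N ih =>
      rw [Finset.sum_range_succ, ih]
      push_cast
      field_simp
      ring
  simp only [this]
  simpa using tendsto_one_div_add_atTop_nhds_zero_nat.const_sub (1 : ℝ)

theorem hasSum_comp_succPNat_iff {f : ℕ+ → ℝ} {s : ℝ} :
    HasSum (fun j : ℕ => f j.succPNat) s ↔ HasSum f s :=
  Equiv.pnatEquivNat.symm.hasSum_iff (f := f)

theorem hasSum_ite_lt (D : ℕ → ℝ) (k : ℕ) :
    HasSum (fun j => if j < k then D j else 0) (∑ j ∈ Finset.range k, D j) := by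
  have := hasSum_sum_of_ne_finset_zero (L := .unconditional ℕ) (s := Finset.range k)
    (f := fun j => if j < k then D j else 0)
    (fun j hj => by simp only [Finset.mem_range] at hj; simp [hj])
  rwa [Finset.sum_congr rfl (g := D)
    (fun j hj => by simp only [Finset.mem_range] at hj; simp [hj])] at this

/-- The source with probabilities proportional to `a` on the first `k` symbols, mixed with
weight `1 / n` with a heavy-tailed source on all symbols. -/
noncomputable def smoothed (n k : ℕ) (a : ℕ → ℝ) (i : ℕ+) : ℝ :=
  (1 - 1 / (n : ℝ)) * (if i.natPred < k then a i.natPred / ∑ j ∈ Finset.range k, a j else 0) +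
    1 / (n : ℝ) * (1 / (((i.natPred : ℝ) + 1) * ((i.natPred : ℝ) + 2)))

section smoothed

variable {n k : ℕ} {a : ℕ → ℝ}

theorem hasSum_smoothed (hk : 1 ≤ k) (ha : ∀ j, 0 < a j) :
    HasSum (smoothed n k a) 1 := by
  have hZ : 0 < ∑ j ∈ Finset.range k, a j :=
    Finset.sum_pos (fun j _ => ha j) (Finset.nonempty_range_iff.2 (by omega))
  have h1 : HasSum (fun j : ℕ => if j < k then a j / ∑ j ∈ Finset.range k, a j else 0) 1 := by
    have := hasSum_ite_lt (fun j => a j / ∑ j ∈ Finset.range k, a j) k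
    rwa [← Finset.sum_div, div_self hZ.ne'] at this
  have := (h1.mul_left (1 - 1 / (n : ℝ))).add (hasSum_one_div_succ_mul_succ.mul_left (1 / (n : ℝ)))
  rw [mul_one, mul_one, sub_add_cancel] at this
  rw [← hasSum_comp_succPNat_iff]
  simp only [smoothed, Nat.natPred_succPNat]
  exact this

theorem smoothed_pos_aux (hn : 2 ≤ n) : (0 : ℝ) < 1 - 1 / n ∧ (0 : ℝ) < 1 / n := by
  have : (2 : ℝ) ≤ n := by exact_mod_cast hn
  have h : (1 : ℝ) / n ≤ 1 / 2 := one_div_le_one_div_of_le (by norm_num) this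
  exact ⟨by linarith, by positivity⟩

theorem le_smoothed (hn : 2 ≤ n) (ha : ∀ j, 0 < a j) (i : ℕ+) :
    1 / (n : ℝ) * (1 / (2 * ((i : ℕ) : ℝ) ^ 2)) ≤ smoothed n k a i := by
  have hZ : 0 ≤ ∑ j ∈ Finset.range k, a j := Finset.sum_nonneg fun j _ => (ha j).le
  obtain ⟨h1, h2⟩ := smoothed_pos_aux hn
  have hi : ((i : ℕ) : ℝ) = i.natPred + 1 := by
    exact_mod_cast (PNat.natPred_add_one i).symm
  have h3 : 1 / (n : ℝ) * (1 / (2 * ((i : ℕ) : ℝ) ^ 2)) ≤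
      1 / (n : ℝ) * (1 / (((i.natPred : ℝ) + 1) * ((i.natPred : ℝ) + 2))) := by
    rw [hi]
    refine mul_le_mul_of_nonneg_left (one_div_le_one_div_of_le (by positivity) ?_) h2.le
    nlinarith [(Nat.cast_nonneg i.natPred : (0 : ℝ) ≤ i.natPred)]
  refine h3.trans (le_add_of_nonneg_left (mul_nonneg h1.le ?_))
  split_ifs
  exacts [div_nonneg (ha _).le hZ, le_rfl]

theorem smoothed_pos (hn : 2 ≤ n) (ha : ∀ j, 0 < a j) (i : ℕ+) : 0 < smoothed n k a i := by
  have hn' : (0 : ℝ) < n := by positivity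
  have hi : (0 : ℝ) < ((i : ℕ) : ℝ) := by exact_mod_cast i.pos
  exact lt_of_lt_of_le (by positivity) (le_smoothed hn ha i)

theorem neg_logb_smoothed_nonneg (hn : 2 ≤ n) (hk : 1 ≤ k) (ha : ∀ j, 0 < a j) (i : ℕ+) :
    0 ≤ -Real.logb 2 (smoothed n k a i) := by
  have h1 : smoothed n k a i ≤ 1 :=
    le_hasSum (hasSum_smoothed hk ha) i fun j _ => (smoothed_pos hn ha j).le
  have := Real.logb_nonpos (b := 2) (by norm_num) (smoothed_pos (k := k) hn ha i).le h1
  linarith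

theorem neg_logb_smoothed_le (hn : 2 ≤ n) (ha : ∀ j, 0 < a j) (i : ℕ+) :
    -Real.logb 2 (smoothed n k a i) ≤
      Real.logb 2 n + 2 * Real.logb 2 ((i : ℕ) : ℝ) + 1 := by
  have hn' : (0 : ℝ) < n := by positivity
  have hi : (0 : ℝ) < ((i : ℕ) : ℝ) := by exact_mod_cast i.pos
  have := Real.logb_le_logb_of_le (b := 2) (by norm_num) (by positivity)
    (le_smoothed (k := k) hn ha i)
  rw [Real.logb_mul (by positivity) (by positivity), one_div, one_div, Real.logb_inv,
    Real.logb_inv, Real.logb_mul (by norm_num) (by positivity), Real.logb_pow,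
    Real.logb_self_eq_one (by norm_num)] at this
  push_cast at this
  linarith

/-- Giving away mass `1/n` costs at most `4/n` bits per main symbol, so only 4 bits per block. -/
theorem neg_logb_smoothed_le_of_lt (hn : 2 ≤ n) (ha : ∀ j, 0 < a j) {i : ℕ+}
    (hi : i.natPred < k) :
    -Real.logb 2 (smoothed n k a i) ≤
      4 / n - Real.logb 2 (a i.natPred / ∑ j ∈ Finset.range k, a j) := by
  have hZ : 0 < ∑ j ∈ Finset.range k, a j :=
    Finset.sum_pos (fun j _ => ha j) (Finset.nonempty_range_iff.2 (by omega))
  obtain ⟨h1, h2⟩ := smoothed_pos_aux hn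
  have hn2 : (2 : ℝ) ≤ n := by exact_mod_cast hn
  have hle : (1 - 1 / (n : ℝ)) * (a i.natPred / ∑ j ∈ Finset.range k, a j) ≤
      smoothed n k a i := by
    rw [smoothed, if_pos hi]
    exact le_add_of_nonneg_right (by positivity)
  have hq : 0 < a i.natPred / ∑ j ∈ Finset.range k, a j := div_pos (ha _) hZ
  have := Real.logb_le_logb_of_le (b := 2) (by norm_num) (mul_pos h1 hq) hle
  rw [Real.logb_mul h1.ne' hq.ne'] at this
  have h4 : -Real.logb 2 (1 - 1 / (n : ℝ)) ≤ 4 / n := by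
    have h5 := Real.one_sub_inv_le_log_of_pos h1
    have h6 : (1 - 1 / (n : ℝ))⁻¹ - 1 ≤ 2 / n := by
      have hn1 : (0 : ℝ) < n - 1 := by linarith
      have : (1 - 1 / (n : ℝ))⁻¹ - 1 = 1 / (n - 1) := by
        field_simp
        ring
      rw [this, div_le_div_iff₀ hn1 (by linarith)]
      linarith
    have h7 : -Real.log (1 - 1 / (n : ℝ)) ≤ 2 / n := by linarith
    rw [Real.logb, ← neg_div, div_eq_mul_inv]
    have h8 : 0 ≤ 2 / (n : ℝ) := by positivity
    calc -Real.log (1 - 1 / (n : ℝ)) * (Real.log 2)⁻¹ ≤ 2 / n * 2 :=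
          mul_le_mul h7 inv_log_two_le (by have := Real.log_pos (x := 2) (by norm_num); positivity) h8
      _ = 4 / n := by ring
  linarith

/-- From `log x ≤ x - 1`, each term is at most `(p - a)² / a + (p - a)` plus the normalization `p
log Z`. Since `s ≤ 1`, the latter sums to at most `Z - s`, which cancels the sum of `p - a`; hence
`a` need not be normalized. -/
theorem sum_mul_log_div_le_chiSq {k : ℕ} {p a : ℕ → ℝ} (hp : ∀ j, 0 ≤ p j) (ha : ∀ j, 0 < a j)
    (hk : 1 ≤ k) (h1 : ∑ j ∈ Finset.range k, p j ≤ 1) :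
    ∑ j ∈ Finset.range k,
        p j * (Real.log (p j) - Real.log (a j / ∑ j ∈ Finset.range k, a j)) ≤
      ∑ j ∈ Finset.range k, (p j - a j) ^ 2 / a j := by
  set Z := ∑ j ∈ Finset.range k, a j
  set s := ∑ j ∈ Finset.range k, p j with hs
  have hZ : 0 < Z := Finset.sum_pos (fun j _ => ha j) (Finset.nonempty_range_iff.2 (by omega))
  have hs0 : 0 ≤ s := Finset.sum_nonneg fun j _ => hp j
  have hterm : ∀ j, p j * (Real.log (p j) - Real.log (a j / Z)) ≤
      (p j - a j) ^ 2 / a j + (p j - a j) + p j * Real.log Z := by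
    intro j
    have haj := ha j
    rw [Real.log_div haj.ne' hZ.ne']
    rcases (hp j).eq_or_lt with h | h
    · rw [← h]
      have : (0 - a j) ^ 2 / a j = a j := by field_simp; ring
      rw [this]; simp
    · have := Real.log_le_sub_one_of_pos (div_pos h haj)
      rw [Real.log_div h.ne' haj.ne'] at this
      have h2 := mul_le_mul_of_nonneg_left this h.le
      have h3 : p j * (p j / a j - 1) = (p j - a j) ^ 2 / a j + (p j - a j) := by
        field_simp; ring
      nlinarith
  have hlogZ : s * Real.log Z ≤ Z - s := by
    rcases hs0.eq_or_lt with h | h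
    · rw [← h]; simp [hZ.le]
    · have := Real.log_le_sub_one_of_pos (div_pos hZ h)
      rw [Real.log_div hZ.ne' h.ne'] at this
      have h2 := Real.log_nonpos hs0 h1
      have h3 : s * Real.log Z ≤ s * (Z / s - 1) :=
        mul_le_mul_of_nonneg_left (by linarith) hs0
      rwa [mul_sub, mul_div_cancel₀ _ h.ne', mul_one] at h3
  have h4 := Finset.sum_le_sum fun j (_ : j ∈ Finset.range k) => hterm j
  rw [Finset.sum_add_distrib, Finset.sum_add_distrib, Finset.sum_sub_distrib,
    ← Finset.sum_mul, ← hs] at h4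
  linarith

end smoothed

theorem MonotonicDist.tailTerm_nonneg (θ : MonotonicDist) (m : ℝ) (i : ℕ+) :
    0 ≤ θ.tailTerm m i := by
  rw [MonotonicDist.tailTerm]
  split_ifs
  · exact mul_nonneg (θ.nonneg i)
      (Real.logb_nonneg (by norm_num) (by exact_mod_cast i.pos))
  · exact le_rfl

theorem MonotonicDist.summable_prob_mul_logb (θ : MonotonicDist) {m : ℝ}
    (hs : Summable (θ.tailTerm m)) :
    Summable fun i : ℕ+ => θ.prob i * Real.logb 2 ((i : ℕ) : ℝ) := by
  have hfin : Summable fun i : ℕ+ =>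
      if m < ((i : ℕ) : ℝ) then 0 else θ.prob i * Real.logb 2 ((i : ℕ) : ℝ) := by
    refine summable_of_hasFiniteSupport ((Set.finite_Iic (⌊m⌋₊.succPNat)).subset ?_)
    intro i hi
    by_contra h
    apply hi
    have hmi : m < ((i : ℕ) : ℝ) := by
      refine Nat.lt_of_floor_lt ?_
      have : ⌊m⌋₊.succPNat < i := not_le.1 h
      have := PNat.coe_lt_coe _ _ |>.2 this
      rw [Nat.succPNat_coe] at this
      omega
    simp [hmi]
  refine (hs.add hfin).congr fun i => ?_
  rw [MonotonicDist.tailTerm]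
  split_ifs <;> simp

theorem MonotonicDist.sum_range_prob_le_one (θ : MonotonicDist) (k : ℕ) :
    ∑ j ∈ Finset.range k, θ.prob j.succPNat ≤ 1 :=
  sum_le_hasSum _ (fun _ _ => θ.nonneg _) (hasSum_comp_succPNat_iff.2 θ.hasSum_one)

/-- The cost of describing a monotonic source by a smoothed approximation. -/
theorem smoothed_cost_le {n : ℕ} (hn : 2 ≤ n) {a : ℕ → ℝ} (ha : ∀ j, 0 < a j) (θ : MonotonicDist)
    {m K : ℝ} (hm : 1 ≤ m) (hK : Real.logb 2 n ≤ K * Real.logb 2 m)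
    (hs : Summable (θ.tailTerm m)) :
    Summable θ.entropyTerm ∧
    Summable (fun i => θ.prob i * -Real.logb 2 (smoothed n ⌊m⌋₊ a i)) ∧
    n * (∑' i, θ.prob i * -Real.logb 2 (smoothed n ⌊m⌋₊ a i) - θ.entropy) ≤
      4 + 2 * (n * ∑ j ∈ Finset.range ⌊m⌋₊, (θ.prob j.succPNat - a j) ^ 2 / a j) +
        (K + 3) * (n * θ.tailCost m) := by
  set k := ⌊m⌋₊ with hkdef
  have hk : 1 ≤ k := Nat.one_le_floor_iff _ |>.2 hm
  have hl2 : 0 < Real.log 2 := Real.log_pos (by norm_num)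
  have hn0 : (0 : ℝ) < n := by positivity
  set φ := smoothed n k a with hφ
  have hφpos : ∀ i, 0 < φ i := smoothed_pos hn ha
  have hsφ : Summable fun i => θ.prob i * -Real.logb 2 (φ i) := by
    refine Summable.of_nonneg_of_le
      (fun i => mul_nonneg (θ.nonneg i) (neg_logb_smoothed_nonneg hn hk ha i))
      (fun i => mul_le_mul_of_nonneg_left (neg_logb_smoothed_le hn ha i) (θ.nonneg i)) ?_
    have := ((θ.hasSum_one.summable.mul_right (Real.logb 2 n + 1))).add
      ((θ.summable_prob_mul_logb hs).mul_left 2)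
    refine this.congr fun i => ?_
    ring
  -- Finite cross-entropy relative to a probability distribution forces finite entropy, by Gibbs'
  -- inequality termwise.
  have hsE : Summable θ.entropyTerm := by
    refine Summable.of_nonneg_of_le θ.entropyTerm_nonneg (fun i => ?_)
      (hsφ.add (((hasSum_smoothed (n := n) hk ha).summable.sub
        θ.hasSum_one.summable).mul_right (Real.log 2)⁻¹))
    rw [MonotonicDist.entropyTerm]
    change _ ≤ θ.prob i * -Real.logb 2 (φ i) + (φ i - θ.prob i) * (Real.log 2)⁻¹
    rcases (θ.nonneg i).eq_or_lt with h | h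
    · rw [← h]
      have := hφpos i
      simp only [zero_mul, neg_zero, sub_zero, zero_add]
      positivity
    · have h1 := Real.log_le_sub_one_of_pos (div_pos (hφpos i) h)
      rw [Real.log_div (hφpos i).ne' h.ne'] at h1
      have h2 := mul_le_mul_of_nonneg_left h1 h.le
      rw [mul_sub (θ.prob i) (_ / _), mul_div_cancel₀ _ h.ne'] at h2
      have h3 := mul_le_mul_of_nonneg_right h2 (inv_nonneg.2 hl2.le)
      simp only [Real.logb, div_eq_mul_inv]
      linarith
  refine ⟨hsE, hsφ, ?_⟩
  set D : ℕ → ℝ := fun j => θ.prob j.succPNat * (4 / n + Real.logb 2 (θ.prob j.succPNat) -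
    Real.logb 2 (a j / ∑ j ∈ Finset.range k, a j)) with hD
  have hfin : HasSum (fun i : ℕ+ => if i.natPred < k then D i.natPred else 0)
      (∑ j ∈ Finset.range k, D j) := by
    rw [← hasSum_comp_succPNat_iff]
    simp only [Nat.natPred_succPNat]
    exact hasSum_ite_lt D k
  have hmaj := hfin.add (hs.hasSum.mul_left (K + 3))
  have hle := hasSum_le (fun i => ?_) (hsφ.hasSum.sub hsE.hasSum) hmaj
  · have hDle : ∑ j ∈ Finset.range k, D j ≤ 4 / n +
        2 * ∑ j ∈ Finset.range k, (θ.prob j.succPNat - a j) ^ 2 / a j := by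
      have h1 := sum_mul_log_div_le_chiSq (p := fun j => θ.prob j.succPNat) (a := a)
        (fun j => θ.nonneg _) ha hk (θ.sum_range_prob_le_one k)
      have h2 : ∑ j ∈ Finset.range k, D j = 4 / n * ∑ j ∈ Finset.range k, θ.prob j.succPNat +
          (Real.log 2)⁻¹ * ∑ j ∈ Finset.range k, θ.prob j.succPNat *
            (Real.log (θ.prob j.succPNat) -
              Real.log (a j / ∑ j ∈ Finset.range k, a j)) := by
        rw [Finset.mul_sum, Finset.mul_sum, ← Finset.sum_add_distrib]
        refine Finset.sum_congr rfl fun j _ => ?_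
        simp only [hD, Real.logb, div_eq_mul_inv (Real.log _)]
        ring
      have h3 : 4 / n * ∑ j ∈ Finset.range k, θ.prob j.succPNat ≤ 4 / n * 1 :=
        mul_le_mul_of_nonneg_left (θ.sum_range_prob_le_one k) (by positivity)
      have h4 : 0 ≤ ∑ j ∈ Finset.range k, (θ.prob j.succPNat - a j) ^ 2 / a j :=
        Finset.sum_nonneg fun j _ => div_nonneg (sq_nonneg _) (ha j).le
      have h5 := (mul_le_mul_of_nonneg_left h1 (inv_nonneg.2 hl2.le)).trans
        (mul_le_mul_of_nonneg_right inv_log_two_le h4)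
      rw [h2]
      linarith
    have h6 := mul_le_mul_of_nonneg_left (hle.trans (add_le_add_left hDle _)) hn0.le
    have h7 : (n : ℝ) * (4 / n) = 4 := by field_simp
    rw [MonotonicDist.entropy, MonotonicDist.tailCost]
    refine h6.trans (le_of_eq ?_)
    linear_combination h7
  · change θ.prob i * -Real.logb 2 (φ i) - -(θ.prob i * Real.logb 2 (θ.prob i)) ≤ _
    have hiN : ((i : ℕ) : ℝ) = i.natPred + 1 := by
      exact_mod_cast (PNat.natPred_add_one i).symm
    by_cases hi : i.natPred < k
    · rw [if_pos hi]
      have h1 := mul_le_mul_of_nonneg_left (neg_logb_smoothed_le_of_lt hn ha hi) (θ.nonneg i)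
      have hm0 : θ.tailTerm m i = 0 := by
        rw [MonotonicDist.tailTerm, if_neg]
        rw [not_lt, hiN]
        calc (i.natPred : ℝ) + 1 ≤ (k : ℝ) := by exact_mod_cast hi
          _ ≤ m := Nat.floor_le (by linarith)
      rw [hm0, mul_zero, add_zero]
      simp only [hD, PNat.succPNat_natPred]
      linarith
    · rw [if_neg hi, zero_add]
      have hmi : m < ((i : ℕ) : ℝ) := by
        rw [hiN]
        exact (Nat.lt_floor_add_one m).trans_le (by
          have : k ≤ i.natPred := not_lt.1 hi
          have : (k : ℝ) ≤ i.natPred := by exact_mod_cast this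
          linarith)
      rw [MonotonicDist.tailTerm, if_pos hmi]
      have h1 := mul_le_mul_of_nonneg_left (neg_logb_smoothed_le (k := k) hn ha i) (θ.nonneg i)
      have h2 := mul_nonneg (θ.nonneg i) (neg_nonneg.2 (θ.logb_prob_nonpos i))
      have h3 : Real.logb 2 m ≤ Real.logb 2 ((i : ℕ) : ℝ) :=
        Real.logb_le_logb_of_le (by norm_num) (by linarith) hmi.le
      -- An integer above `m ≥ 1` is at least 2, so `log i` absorbs the constant 1; together with
      -- `log n ≤ K log i` this gives `K + 3`.
      have h4 : 1 ≤ Real.logb 2 ((i : ℕ) : ℝ) := by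
        have : (2 : ℝ) ≤ ((i : ℕ) : ℝ) := by
          have : (1 : ℝ) < ((i : ℕ) : ℝ) := hm.trans_lt hmi
          exact_mod_cast this
        calc (1 : ℝ) = Real.logb 2 2 := (Real.logb_self_eq_one (by norm_num)).symm
          _ ≤ _ := Real.logb_le_logb_of_le (by norm_num) (by norm_num) this
      have h5 : K * Real.logb 2 m ≤ K * Real.logb 2 ((i : ℕ) : ℝ) := by
        rcases le_or_gt 0 K with h | h
        · exact mul_le_mul_of_nonneg_left h3 h
        · exfalso
          have : 0 < Real.logb 2 (n : ℝ) := Real.logb_pos (by norm_num) (by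
            have : (2 : ℝ) ≤ n := by exact_mod_cast hn
            linarith)
          have := mul_nonpos_of_nonpos_of_nonneg h.le (Real.logb_nonneg (b := 2) (by norm_num) hm)
          linarith
      have h6 : θ.prob i * (Real.logb 2 n + 2 * Real.logb 2 ((i : ℕ) : ℝ) + 1) ≤
          θ.prob i * ((K + 3) * Real.logb 2 ((i : ℕ) : ℝ)) :=
        mul_le_mul_of_nonneg_left (by linarith) (θ.nonneg i)
      linarith

/-! ### Approximation by sources with geometrically coded increments -/

/-- The geometric distribution with scale `c`. -/
noncomputable def geomWeight (c : ℝ) (d : ℕ) : ℝ := (1 - 1 / (2 * c)) ^ d / (2 * c)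

theorem geomWeight_ratio {c : ℝ} (hc : 1 ≤ c) :
    0 < 1 / (2 * c) ∧ 1 / (2 * c) ≤ 1 / 2 := by
  refine ⟨by positivity, one_div_le_one_div_of_le (by norm_num) (by linarith)⟩

theorem geomWeight_pos {c : ℝ} (hc : 1 ≤ c) (d : ℕ) : 0 < geomWeight c d := by
  obtain ⟨h1, h2⟩ := geomWeight_ratio hc
  exact div_pos (pow_pos (by linarith) d) (by linarith)

theorem hasSum_geomWeight {c : ℝ} (hc : 1 ≤ c) : HasSum (geomWeight c) 1 := by
  obtain ⟨h1, h2⟩ := geomWeight_ratio hc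
  have := (hasSum_geometric_of_lt_one (r := 1 - 1 / (2 * c)) (by linarith)
    (by linarith)).div_const (2 * c)
  have e : (1 - (1 - 1 / (2 * c)))⁻¹ / (2 * c) = 1 := by
    have : c ≠ 0 := by linarith
    field_simp
    ring
  rwa [e] at this

/-- Stopping probability `1/(2c)`, at most one half, keeps the logarithm of the ratio of order
`1/c`; values of order `c` then cost `log c + O(1)` bits. -/
theorem neg_logb_geomWeight_le {c : ℝ} (hc : 1 ≤ c) (d : ℕ) :
    -Real.logb 2 (geomWeight c d) ≤ 1 + Real.logb 2 c + 2 * (d * (1 / c)) := by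
  obtain ⟨h1, h2⟩ := geomWeight_ratio hc
  have hr : 0 < 1 - 1 / (2 * c) := by linarith
  have h3 := Real.one_sub_inv_le_log_of_pos hr
  have h4 : (1 - 1 / (2 * c))⁻¹ - 1 ≤ 1 / c := by
    have : (1 - 1 / (2 * c))⁻¹ - 1 = 1 / (2 * c - 1) := by
      have h5 : 2 * c - 1 ≠ 0 := by linarith
      have h6 : 1 - 1 / (2 * c) = (2 * c - 1) / (2 * c) := by field_simp
      rw [h6, inv_div]
      field_simp
      ring
    rw [this]
    exact one_div_le_one_div_of_le (by linarith) (by linarith)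
  have h5 : -Real.logb 2 (1 - 1 / (2 * c)) ≤ 2 * (1 / c) := by
    have h7 : 0 ≤ 1 / c := by positivity
    have h8 : -Real.log (1 - 1 / (2 * c)) ≤ 1 / c := by linarith
    rw [Real.logb, ← neg_div, div_eq_mul_inv]
    have h9 := mul_le_mul_of_nonneg_right h8
      (inv_nonneg.2 (Real.log_pos (x := 2) (by norm_num)).le)
    have h10 := mul_le_mul_of_nonneg_left inv_log_two_le h7
    linarith
  rw [geomWeight, Real.logb_div (by positivity) (by positivity), Real.logb_pow,
    Real.logb_mul (by norm_num) (by positivity), Real.logb_self_eq_one (by norm_num)]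
  have := mul_le_mul_of_nonneg_left h5 (Nat.cast_nonneg (α := ℝ) d)
  linarith

/-- The typical size of the decrement of `√(n θᵢ)` at the symbol `j + 1`. -/
noncomputable def decrementScale (n j : ℕ) : ℝ := max 1 √((n : ℝ) / ((j : ℝ) + 1) ^ 3)

/-- The unnormalized source whose square-root weights have the decrements `d`. -/
noncomputable def decrementSource (n : ℕ) {k : ℕ} (d : Fin k → ℕ) (j : ℕ) : ℝ :=
  (1 + ((∑ l : Fin k, if j ≤ (l : ℕ) then d l else 0 : ℕ) : ℝ)) ^ 2 / n

theorem MonotonicDist.prob_succPNat_le (θ : MonotonicDist) (j : ℕ) :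
    θ.prob j.succPNat ≤ 1 / ((j : ℝ) + 1) := by
  have h := θ.sum_range_prob_le_one (j + 1)
  have h2 : ∑ _l ∈ Finset.range (j + 1), θ.prob j.succPNat ≤
      ∑ l ∈ Finset.range (j + 1), θ.prob l.succPNat :=
    Finset.sum_le_sum fun l hl =>
      θ.antitone (Nat.succPNat_le_succPNat.2 (by simp only [Finset.mem_range] at hl; omega))
  rw [Finset.sum_const, Finset.card_range, nsmul_eq_mul] at h2
  rw [le_div_iff₀ (by positivity)]
  push_cast at h2
  linarith

/-- Summation by parts: the weight grows by at most `2√(r+1) / √n` at step `r`, while `u r ≤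
√(n/(r+1))`, so each symbol contributes at most 2. The term with `u r` is the boundary term that
carries the induction. -/
theorem sum_decrement_mul_le {n k : ℕ} (hn : 1 ≤ n) {u : ℕ → ℕ} (hu : Antitone u)
    (hle : ∀ j < k, (u j : ℝ) ≤ √((n : ℝ) / ((j : ℝ) + 1))) (r : ℕ) (hr : r ≤ k) :
    ∑ j ∈ Finset.range r,
        ((u j - u (j + 1) : ℕ) : ℝ) * ((((j : ℝ) + 1) * √((j : ℝ) + 1)) / √n) +
      u r * ((r * √r) / √n) ≤ 2 * r := by
  have hn0 : (0 : ℝ) < √(n : ℝ) := Real.sqrt_pos.2 (by positivity)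
  induction r with
  | zero => simp
  | succ r ih =>
    have h1 := ih (by omega)
    rw [Finset.sum_range_succ, Nat.cast_sub (hu (by omega))]
    push_cast
    have hs1 : 0 < √((r : ℝ) + 1) := Real.sqrt_pos.2 (by positivity)
    have hinc : (((r : ℝ) + 1) * √((r : ℝ) + 1)) - r * √r ≤ 2 * √((r : ℝ) + 1) := by
      have q1 := Real.sq_sqrt (show (0 : ℝ) ≤ (r : ℝ) + 1 by positivity)
      have q2 := Real.sq_sqrt (show (0 : ℝ) ≤ (r : ℝ) by positivity)
      have q3 : √(r : ℝ) ≤ √((r : ℝ) + 1) := Real.sqrt_le_sqrt (by linarith)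
      have q4 : 0 ≤ √(r : ℝ) := Real.sqrt_nonneg _
      set x := √((r : ℝ) + 1)
      set y := √(r : ℝ)
      have e1 : (r : ℝ) = y ^ 2 := q2.symm
      have e2 : x ^ 2 = y ^ 2 + 1 := by rw [q1, e1]
      rw [e1]
      have : y ^ 2 * (x - y) ≤ x := by
        have h5 : (x - y) * (x + y) = 1 := by nlinarith
        have h6 : y * (x - y) ≤ 1 := by nlinarith
        nlinarith
      nlinarith
    have h3 := hle r (by omega)
    rw [Real.sqrt_div (by positivity)] at h3
    have h4 : (u r : ℝ) * (((((r : ℝ) + 1) * √((r : ℝ) + 1)) - r * √r) / √n) ≤ 2 := by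
      calc (u r : ℝ) * (((((r : ℝ) + 1) * √((r : ℝ) + 1)) - r * √r) / √n)
          ≤ u r * (2 * √((r : ℝ) + 1) / √n) := by gcongr
        _ ≤ √n / √((r : ℝ) + 1) * (2 * √((r : ℝ) + 1) / √n) := by gcongr
        _ = 2 := by field_simp
    rw [sub_div, mul_sub] at h4
    linarith

theorem mul_logb_sub_le_logb_factorial (k : ℕ) :
    k * Real.logb 2 k - 2 * k ≤ Real.logb 2 (k.factorial : ℝ) := by
  rcases Nat.eq_zero_or_pos k with rfl | hk
  · simp
  have hl2 : 0 < Real.log 2 := Real.log_pos (by norm_num)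
  have h := Real.pow_div_factorial_le_exp (k : ℝ) (by positivity) k
  have h1 := Real.log_le_log (by positivity) h
  rw [Real.log_exp, Real.log_div (by positivity) (by positivity), Real.log_pow] at h1
  have h2 := mul_le_mul_of_nonneg_right h1 (inv_nonneg.2 hl2.le)
  have h3 := mul_le_mul_of_nonneg_left inv_log_two_le (Nat.cast_nonneg (α := ℝ) k)
  simp only [Real.logb, div_eq_mul_inv]
  linarith

/-- On the square-root scale a unit rounding error is harmless whatever the size of `θ_j`, and
decreasing integers are cheap to describe by their decrements. -/
theorem exists_decrementSource {n k : ℕ} (hn : 1 ≤ n) (hkn : k ^ 3 ≤ n) (θ : MonotonicDist) :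
    ∃ d : Fin k → ℕ,
      (∑ l : Fin k, -Real.logb 2 (geomWeight (decrementScale n l) (d l)) ≤
        k / 2 * (Real.logb 2 n - 3 * Real.logb 2 k) + 8 * k) ∧
      n * ∑ j ∈ Finset.range k,
        (θ.prob j.succPNat - decrementSource n d j) ^ 2 / decrementSource n d j ≤ 4 * k := by
  have hn0 : (0 : ℝ) < n := by positivity
  -- Vanishing from `k` on makes the last decrement the last value, so the decrements sum back to `u
  -- j`.
  set u : ℕ → ℕ := fun j => if j < k then ⌊√(n * θ.prob j.succPNat)⌋₊ else 0 with hu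
  have huanti : Antitone u := by
    intro i j hij
    simp only [hu]
    by_cases hj : j < k
    · rw [if_pos hj, if_pos (by omega)]
      refine Nat.floor_mono (Real.sqrt_le_sqrt (mul_le_mul_of_nonneg_left ?_ hn0.le))
      exact θ.antitone (Nat.succPNat_le_succPNat.2 hij)
    · rw [if_neg hj]; exact Nat.zero_le _
  have hule : ∀ j < k, (u j : ℝ) ≤ √((n : ℝ) / ((j : ℝ) + 1)) := by
    intro j hj
    simp only [hu, if_pos hj]
    refine (Nat.floor_le (Real.sqrt_nonneg _)).trans (Real.sqrt_le_sqrt ?_)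
    rw [div_eq_mul_one_div]
    exact mul_le_mul_of_nonneg_left (θ.prob_succPNat_le j) hn0.le
  have htel : ∀ j < k, (∑ l : Fin k, if j ≤ (l : ℕ) then u l - u (l + 1) else 0) = u j := by
    intro j hj
    rw [Fin.sum_univ_eq_sum_range (fun l => if j ≤ l then u l - u (l + 1) else 0) k,
      ← Finset.sum_filter]
    have : (Finset.range k).filter (fun l => j ≤ l) = Finset.Ico j k := by
      ext l; simp only [Finset.mem_filter, Finset.mem_range, Finset.mem_Ico]; omega
    rw [this]
    have huk : u k = 0 := by simp [hu]
    have hind : ∀ t, j ≤ t → (∑ l ∈ Finset.Ico j t, (u l - u (l + 1))) = u j - u t := by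
      intro t ht
      induction t, ht using Nat.le_induction with
      | base => simp
      | succ t ht ih =>
        rw [Finset.sum_Ico_succ_top ht, ih]
        have := huanti ht
        have := huanti (show t ≤ t + 1 by omega)
        omega
    rw [hind k hj.le, huk, Nat.sub_zero]
  refine ⟨fun l => u l - u (l + 1), ?_, ?_⟩
  · have hscale : ∀ j < k, decrementScale n j = √((n : ℝ) / ((j : ℝ) + 1) ^ 3) := by
      intro j hj
      refine max_eq_right ?_
      rw [Real.le_sqrt (by norm_num) (by positivity), one_pow, le_div_iff₀ (by positivity), one_mul]
      have : (j + 1) ^ 3 ≤ n := (Nat.pow_le_pow_left hj 3).trans hkn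
      exact_mod_cast this
    have hterm : ∀ l : Fin k,
        -Real.logb 2 (geomWeight (decrementScale n l) (u l - u (l + 1))) ≤
          1 + (1 / 2 * Real.logb 2 n - 3 / 2 * Real.logb 2 ((((l : ℕ) + 1 : ℕ) : ℝ))) +
            2 * (((u l - u (l + 1) : ℕ) : ℝ) *
              (((((l : ℕ) : ℝ) + 1) * √(((l : ℕ) : ℝ) + 1)) / √n)) := by
      intro l
      refine (neg_logb_geomWeight_le (c := decrementScale n l) (le_max_left _ _) _).trans (le_of_eq ?_)
      rw [hscale l l.2]
      have hl0 : (0 : ℝ) < ((l : ℕ) : ℝ) + 1 := by positivity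
      have e1 : Real.logb 2 √((n : ℝ) / (((l : ℕ) : ℝ) + 1) ^ 3) =
          1 / 2 * Real.logb 2 n - 3 / 2 * Real.logb 2 ((((l : ℕ) + 1 : ℕ) : ℝ)) := by
        rw [Real.logb, Real.log_sqrt (by positivity), Real.log_div (by positivity) (by positivity),
          Real.log_pow, Real.logb, Real.logb]
        push_cast
        ring
      have e2 : 1 / √((n : ℝ) / (((l : ℕ) : ℝ) + 1) ^ 3) =
          ((((l : ℕ) : ℝ) + 1) * √(((l : ℕ) : ℝ) + 1)) / √n := by
        rw [Real.sqrt_div hn0.le, one_div_div, pow_succ, Real.sqrt_mul (by positivity),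
          Real.sqrt_sq hl0.le]
      rw [e1, e2]
    refine (Finset.sum_le_sum fun l _ => hterm l).trans ?_
    rw [Fin.sum_univ_eq_sum_range (fun l =>
      1 + (1 / 2 * Real.logb 2 n - 3 / 2 * Real.logb 2 (((l + 1 : ℕ) : ℝ))) +
            2 * (((u l - u (l + 1) : ℕ) : ℝ) * ((((l : ℝ) + 1) * √((l : ℝ) + 1)) / √n))) k]
    rw [Finset.sum_add_distrib, Finset.sum_add_distrib, Finset.sum_sub_distrib, ← Finset.mul_sum,
      ← Finset.mul_sum, ← Finset.mul_sum]
    have hfac : ∑ l ∈ Finset.range k, Real.logb 2 (((l + 1 : ℕ) : ℝ)) =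
        Real.logb 2 (k.factorial : ℝ) := by
      rw [← Finset.prod_range_add_one_eq_factorial, Nat.cast_prod, Real.logb_prod]
      intro l _
      positivity
    -- The `8 * k` is `k` from the geometric constants, `3k` from the bound on the factorial, and
    -- `4k` from twice the weighted decrements.
    have h1 := sum_decrement_mul_le hn huanti hule k le_rfl
    have h2 : 0 ≤ (u k : ℝ) * ((k * √(k : ℝ)) / √n) := by positivity
    have h3 := mul_logb_sub_le_logb_factorial k
    rw [hfac]
    simp only [Finset.sum_const, Finset.card_range, nsmul_eq_mul]
    linarith
  · have hterm : ∀ j ∈ Finset.range k, (θ.prob j.succPNat -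
        decrementSource n (fun l : Fin k => u l - u (l + 1)) j) ^ 2 /
          decrementSource n (fun l : Fin k => u l - u (l + 1)) j ≤ 4 / n := by
      intro j hj
      have hj' := Finset.mem_range.1 hj
      rw [decrementSource, htel j hj']
      have hp := θ.nonneg j.succPNat
      have hy2 := Real.sq_sqrt (show 0 ≤ (n : ℝ) * θ.prob j.succPNat by positivity)
      have hy0 := Real.sqrt_nonneg ((n : ℝ) * θ.prob j.succPNat)
      have h1 : (u j : ℝ) ≤ √((n : ℝ) * θ.prob j.succPNat) := by
        simp only [hu, if_pos hj']; exact Nat.floor_le hy0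
      have h2 : √((n : ℝ) * θ.prob j.succPNat) < 1 + u j := by
        simp only [hu, if_pos hj']; rw [add_comm]; exact Nat.lt_floor_add_one _
      set y := √((n : ℝ) * θ.prob j.succPNat)
      set t : ℝ := 1 + u j with ht
      have ht0 : 0 < t := by positivity
      have e : θ.prob j.succPNat = y ^ 2 / n := by rw [hy2]; field_simp
      have e2 : (y ^ 2 / n - t ^ 2 / n) ^ 2 / (t ^ 2 / n) =
          ((t - y) * (t + y)) ^ 2 / (t ^ 2 * n) := by
        field_simp
        ring
      rw [e, e2, div_le_div_iff₀ (by positivity) hn0]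
      -- Here `y ≤ t ≤ y + 1`. The added 1 in `t` keeps the source positive where the floor is zero.
      have h3 : (t - y) * (t + y) ≤ 2 * t := by nlinarith
      have h4 : 0 ≤ (t - y) * (t + y) := mul_nonneg (by linarith) (by linarith)
      have h5 : ((t - y) * (t + y)) ^ 2 ≤ (2 * t) ^ 2 := pow_le_pow_left₀ h4 h3 2
      nlinarith
    have h := mul_le_mul_of_nonneg_left (Finset.sum_le_sum hterm) hn0.le
    rw [Finset.sum_const, Finset.card_range, nsmul_eq_mul] at h
    refine h.trans (le_of_eq ?_)
    field_simp

/-! ### Approximation by sources with geometrically spaced levels -/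

/-- A downward closed subset of `range J` is an initial segment, so its cardinality is its
threshold. -/
theorem lt_card_filter_range_iff {p : ℕ → Prop} [DecidablePred p]
    (hp : ∀ i j, i ≤ j → p j → p i) {J l : ℕ} (hl : l < J) :
    l < ((Finset.range J).filter p).card ↔ p l := by
  constructor
  · intro h
    by_contra hpl
    have : (Finset.range J).filter p ⊆ Finset.range l := by
      intro i hi
      simp only [Finset.mem_filter, Finset.mem_range] at hi ⊢
      by_contra hil
      exact hpl (hp l i (by omega) hi.2)
    have := Finset.card_le_card this
    rw [Finset.card_range] at this
    omega
  · intro hpl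
    have : Finset.range (l + 1) ⊆ (Finset.range J).filter p := by
      intro i hi
      simp only [Finset.mem_filter, Finset.mem_range] at hi ⊢
      exact ⟨by omega, hp i l (by omega) hpl⟩
    have := Finset.card_le_card this
    rw [Finset.card_range] at this
    omega

/-- The unnormalized source with values in the powers of `exp (-δ)`, whose exponent
increases at the positions `b`. -/
noncomputable def levelSource (δ : ℝ) {J k : ℕ} (b : Fin J → Fin (k + 1)) (j : ℕ) : ℝ :=
  Real.exp (-(δ * ((Finset.univ.filter fun l => (b l : ℕ) ≤ j).card : ℝ)))

/-- Above the lowest level, rounding up has relative error at most `δ`, giving chi-square at most `3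
δ² θ_j`. At the lowest level the value is at most `1/(kn)`, so all such symbols together contribute
at most `1/n`. -/
theorem exists_levelSource {n k J : ℕ} (hn : 1 ≤ n) (hk : 1 ≤ k) {δ : ℝ} (hδ : 0 < δ)
    (hδ1 : δ ≤ 1) (hJ : Real.log (k * n) ≤ δ * J) (θ : MonotonicDist) :
    ∃ b : Fin J → Fin (k + 1),
      n * ∑ j ∈ Finset.range k,
        (θ.prob j.succPNat - levelSource δ b j) ^ 2 / levelSource δ b j ≤ 3 * (n * δ ^ 2) + 1 := by
  classical
  have hn0 : (0 : ℝ) < n := by positivity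
  have hk0 : (0 : ℝ) < k := by positivity
  -- `B l` is the first main symbol with probability below `exp (-δ(l+1))`, or `k` if there is none;
  -- hence `k + 1` possible values.
  set B : ℕ → ℕ := fun l => ((Finset.range k).filter fun j =>
    Real.exp (-(δ * (l + 1))) ≤ θ.prob j.succPNat).card with hB
  have hBk : ∀ l, B l < k + 1 := fun l => by
    have := Finset.card_filter_le (Finset.range k) fun j =>
      Real.exp (-(δ * (l + 1))) ≤ θ.prob j.succPNat
    rw [Finset.card_range] at this
    simp only [hB]; omega
  have hBle : ∀ l, ∀ j < k, B l ≤ j ↔ θ.prob j.succPNat < Real.exp (-(δ * (l + 1))) := by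
    intro l j hj
    rw [← not_lt, lt_card_filter_range_iff _ hj, not_le]
    intro i j hij h
    exact h.trans (θ.antitone (Nat.succPNat_le_succPNat.2 hij))
  refine ⟨fun l => ⟨B l, hBk l⟩, ?_⟩
  set V : ℕ → ℕ := fun j => ((Finset.range J).filter fun l => B l ≤ j).card with hV
  have hlev : ∀ j, levelSource δ (fun l : Fin J => (⟨B l, hBk l⟩ : Fin (k + 1))) j =
      Real.exp (-(δ * V j)) := by
    intro j
    rw [levelSource]
    congr 4
    simp only [hV, Finset.card_filter]
    exact Fin.sum_univ_eq_sum_range (fun l => if B l ≤ j then 1 else 0) J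
  have hVle : ∀ j, V j ≤ J := fun j => by
    have := Finset.card_filter_le (Finset.range J) fun l => B l ≤ j
    rwa [Finset.card_range] at this
  have hVlt : ∀ j < k, ∀ l < J, l < V j ↔ θ.prob j.succPNat < Real.exp (-(δ * (l + 1))) := by
    intro j hj l hl
    rw [lt_card_filter_range_iff _ hl, hBle l j hj]
    intro i i' hii h
    rw [hBle _ j hj] at h ⊢
    refine h.trans_le (Real.exp_le_exp.2 (neg_le_neg (mul_le_mul_of_nonneg_left ?_ hδ.le)))
    have : (i : ℝ) ≤ i' := by exact_mod_cast hii
    linarith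
  have hterm : ∀ j ∈ Finset.range k, (θ.prob j.succPNat -
      levelSource δ (fun l : Fin J => (⟨B l, hBk l⟩ : Fin (k + 1))) j) ^ 2 /
        levelSource δ (fun l : Fin J => (⟨B l, hBk l⟩ : Fin (k + 1))) j ≤
      3 * δ ^ 2 * θ.prob j.succPNat + 1 / (k * n) := by
    intro j hj
    have hj' := Finset.mem_range.1 hj
    rw [hlev j]
    have hp := θ.nonneg j.succPNat
    set p := θ.prob j.succPNat with hpdef
    set a := Real.exp (-(δ * V j)) with ha
    have ha0 : 0 < a := Real.exp_pos _
    have hpa : p ≤ a := by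
      rcases Nat.eq_zero_or_pos (V j) with h | h
      · rw [ha, h]; simpa using θ.prob_le_one _
      · have h1 := (hVlt j hj' (V j - 1) (by have := hVle j; omega)).1 (by omega)
        rw [Nat.cast_sub h] at h1
        simpa using h1.le
    rcases (hVle j).lt_or_eq with h | h
    · have h1 := mt (hVlt j hj' (V j) h).2 (lt_irrefl _)
      rw [not_lt, ← hpdef] at h1
      have h2 : a * Real.exp (-δ) ≤ p := by
        rw [ha, ← Real.exp_add]
        refine (le_of_eq ?_).trans h1
        congr 1; ring
      have h3 := Real.add_one_le_exp (-δ)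
      have h4 : a - p ≤ a * δ := by nlinarith
      -- As `δ ≤ 1`, one level is a factor at most `e < 3`.
      have h5 : a ≤ 3 * p := by
        have h6 : (1 : ℝ) ≤ 3 * Real.exp (-δ) := by
          have : Real.exp (-1) ≤ Real.exp (-δ) := Real.exp_le_exp.2 (by linarith)
          have h7 := Real.exp_one_lt_d9
          have h8 : Real.exp (-1) * Real.exp 1 = 1 := by rw [← Real.exp_add]; simp
          nlinarith [Real.exp_pos (-1)]
        nlinarith
      have h6 : (p - a) ^ 2 / a ≤ 3 * δ ^ 2 * p := by
        rw [div_le_iff₀ ha0]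
        have h7 : (a - p) ^ 2 ≤ (a * δ) ^ 2 := pow_le_pow_left₀ (by linarith) h4 2
        have h8 : a * (a * δ ^ 2) ≤ a * (3 * p * δ ^ 2) :=
          mul_le_mul_of_nonneg_left (mul_le_mul_of_nonneg_right h5 (sq_nonneg _)) ha0.le
        nlinarith
      have h7 : (0 : ℝ) ≤ 1 / (k * n) := by positivity
      linarith
    · have h1 : a ≤ 1 / (k * n) := by
        rw [ha, h, Real.exp_neg, one_div]
        refine inv_anti₀ (by positivity) ?_
        rw [← Real.log_le_iff_le_exp (by positivity)]
        exact hJ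
      have h2 : (p - a) ^ 2 / a ≤ a := by
        rw [div_le_iff₀ ha0]
        nlinarith
      have h3 : 0 ≤ 3 * δ ^ 2 * p := by positivity
      linarith
  have h := Finset.sum_le_sum hterm
  rw [Finset.sum_add_distrib, ← Finset.mul_sum, Finset.sum_const, Finset.card_range,
    nsmul_eq_mul] at h
  have h1 : 3 * δ ^ 2 * ∑ j ∈ Finset.range k, θ.prob j.succPNat ≤ 3 * δ ^ 2 * 1 :=
    mul_le_mul_of_nonneg_left (θ.sum_range_prob_le_one k) (by positivity)
  have h2 := mul_le_mul_of_nonneg_left (h.trans (add_le_add_left h1 _)) hn0.le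
  refine h2.trans (le_of_eq ?_)
  field_simp

/-! ### A universal code -/

/-- The logarithmic spacing of the levels. -/
noncomputable def levelStep (n : ℕ) : ℝ := √(Real.logb 2 n) / (n : ℝ) ^ ((1 : ℝ) / 3)

/-- The number of levels used for `k` symbols. -/
noncomputable def levelCount (n k : ℕ) : ℕ := ⌈Real.log (k * n) / levelStep n⌉₊

/-- The parameters of the sources with `k + 1` main symbols that enter the universal mixture. -/
abbrev SourceIndex (n k : ℕ) : Type :=
  (Fin (k + 1) → ℕ) ⊕ (Fin (levelCount n (k + 1)) → Fin (k + 1 + 1))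

/-- The weights of the sources with `k + 1` main symbols. -/
noncomputable def indexWeight (n k : ℕ) : SourceIndex n k → ℝ
  | .inl d => 1 / 2 * ∏ l : Fin (k + 1), geomWeight (decrementScale n l) (d l)
  | .inr _ => 1 / 2 * (1 / ((k : ℝ) + 1 + 1) ^ levelCount n (k + 1))

/-- The unnormalized probabilities of the sources with `k + 1` main symbols. -/
noncomputable def indexSource (n k : ℕ) : SourceIndex n k → ℕ → ℝ
  | .inl d => decrementSource n d
  | .inr b => levelSource (levelStep n) b

theorem indexWeight_pos (n k : ℕ) (s : SourceIndex n k) : 0 < indexWeight n k s := by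
  rcases s with d | b
  · exact mul_pos (by norm_num)
      (Finset.prod_pos fun l _ => geomWeight_pos (le_max_left _ _) _)
  · simp only [indexWeight]; positivity

theorem hasSum_indexWeight (n k : ℕ) : HasSum (indexWeight n k) 1 := by
  have h1 : HasSum (indexWeight n k ∘ Sum.inl) (1 / 2 * 1) := by
    have := hasSum_pi_prod (n := k + 1) (f := fun l => geomWeight (decrementScale n l))
      (F := fun _ => 1) (fun l d => (geomWeight_pos (le_max_left _ _) d).le)
      (fun l => hasSum_geomWeight (le_max_left _ _))
    rw [Finset.prod_const_one] at this
    exact this.mul_left _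
  have h2 : HasSum (indexWeight n k ∘ Sum.inr) (1 / 2 * 1) := by
    have := hasSum_fintype (L := .unconditional _) (indexWeight n k ∘ Sum.inr)
    convert this using 1
    simp only [Function.comp, indexWeight, Finset.sum_const, Finset.card_univ, Fintype.card_fun,
      Fintype.card_fin, nsmul_eq_mul]
    push_cast
    field_simp
  have := h1.sum h2
  norm_num at this
  exact this

theorem indexSource_pos {n k : ℕ} (hn : 1 ≤ n) (s : SourceIndex n k) (j : ℕ) :
    0 < indexSource n k s j := by
  rcases s with d | b
  · simp only [indexSource, decrementSource]; positivity
  · simp only [indexSource, levelSource]; positivity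

theorem hasSum_sigma_indexWeight (n : ℕ) :
    HasSum (fun s : (k : ℕ) × SourceIndex n k =>
      1 / (((s.1 : ℝ) + 1) * ((s.1 : ℝ) + 2)) * indexWeight n s.1 s.2) 1 := by
  have h1 : ∀ k : ℕ, HasSum (fun s => 1 / (((k : ℝ) + 1) * ((k : ℝ) + 2)) * indexWeight n k s)
      (1 / (((k : ℝ) + 1) * ((k : ℝ) + 2))) := fun k => by
    simpa only [mul_one] using
      (hasSum_indexWeight n k).mul_left (1 / (((k : ℝ) + 1) * ((k : ℝ) + 2)))
  refine HasSum.sigma_of_hasSum hasSum_one_div_succ_mul_succ h1 ?_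
  rw [summable_sigma_of_nonneg
    (fun s => mul_nonneg (by positivity) (indexWeight_pos n s.1 s.2).le)]
  refine ⟨fun k => (h1 k).summable, ?_⟩
  simp only [(h1 _).tsum_eq]
  exact hasSum_one_div_succ_mul_succ.summable

/-- The cost bounds satisfied by the universal code. -/
def BlockCode.IsUniversal {n : ℕ} (C : BlockCode n) : Prop :=
  C.KraftLe ∧
    ∀ (θ : MonotonicDist) (m K : ℝ), 1 ≤ m → Real.logb 2 n ≤ K * Real.logb 2 m →
      Summable (θ.tailTerm m) →
      FiniteRedundancy C θ ∧
      (⌊m⌋₊ ^ 3 ≤ n → n * redundancy C θ ≤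
        ⌊m⌋₊ / 2 * (Real.logb 2 n - 3 * Real.logb 2 ⌊m⌋₊) + 16 * ⌊m⌋₊ +
          2 * Real.logb 2 (⌊m⌋₊ + 1) + 7 + (K + 3) * (n * θ.tailCost m)) ∧
      (levelStep n ≤ 1 → n * redundancy C θ ≤
        (levelCount n ⌊m⌋₊ + 2) * Real.logb 2 (⌊m⌋₊ + 1) + 6 * (n * levelStep n ^ 2) + 9 +
          (K + 3) * (n * θ.tailCost m))

/-- The mixture is fixed first; the component is chosen afterwards, depending on `θ` and `m`, only
to bound the code length. -/
theorem exists_universal_code {n : ℕ} (hn : 2 ≤ n) :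
    ∃ C : BlockCode n, C.IsUniversal := by
  have hlogpos : 0 < Real.logb 2 (n : ℝ) := Real.logb_pos (by norm_num) (by
    have : (2 : ℝ) ≤ n := by exact_mod_cast hn
    linarith)
  have hstep : 0 < levelStep n := div_pos (Real.sqrt_pos.2 hlogpos) (by positivity)
  have : Nonempty ((k : ℕ) × SourceIndex n k) := ⟨⟨0, .inl fun _ => 0⟩⟩
  obtain ⟨C, hC, hlen⟩ := exists_mixture_code n
    (w := fun s : (k : ℕ) × SourceIndex n k =>
      1 / (((s.1 : ℝ) + 1) * ((s.1 : ℝ) + 2)) * indexWeight n s.1 s.2)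
    (fun s => mul_pos (by positivity) (indexWeight_pos n s.1 s.2))
    (hasSum_sigma_indexWeight n).summable (hasSum_sigma_indexWeight n).tsum_eq.le
    (φ := fun s => smoothed n (s.1 + 1) (indexSource n s.1 s.2))
    (fun s => smoothed_pos hn (indexSource_pos (by omega) s.2))
    (fun s => hasSum_smoothed (by omega) (indexSource_pos (by omega) s.2))
  refine ⟨C, hC, fun θ m K hm hK hs => ?_⟩
  obtain ⟨κ, hκ⟩ : ∃ κ, ⌊m⌋₊ = κ + 1 :=
    ⟨⌊m⌋₊ - 1, by have := Nat.one_le_floor_iff _ |>.2 hm; omega⟩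
  -- The 6 is 2 from coding plus 4 from smoothing, and the logarithm pays for the prior on `k`. One
  -- further bit names the family.
  have key : ∀ s : SourceIndex n κ, FiniteRedundancy C θ ∧
      n * redundancy C θ ≤ 6 + 2 * Real.logb 2 (⌊m⌋₊ + 1) - Real.logb 2 (indexWeight n κ s) +
        2 * (n * ∑ j ∈ Finset.range ⌊m⌋₊,
          (θ.prob j.succPNat - indexSource n κ s j) ^ 2 / indexSource n κ s j) +
        (K + 3) * (n * θ.tailCost m) := by
    intro s
    have ha := indexSource_pos (n := n) (by omega) s
    obtain ⟨hE, hS, hcost⟩ := smoothed_cost_le hn ha θ hm hK hs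
    obtain ⟨h1, h2⟩ := summable_expTerm_and_redundancy_le (by omega) C θ
      (neg_logb_smoothed_nonneg hn (by omega) ha) (fun x => hlen ⟨κ, s⟩ x)
      (by rw [← hκ]; exact hS.hasSum)
    refine ⟨⟨h1, hE⟩, ?_⟩
    dsimp only at h2
    rw [Real.logb_mul (by positivity) (indexWeight_pos n κ s).ne', one_div, Real.logb_inv] at h2
    have h3 : Real.logb 2 (((κ : ℝ) + 1) * ((κ : ℝ) + 2)) ≤ 2 * Real.logb 2 (⌊m⌋₊ + 1) := by
      have : (2 : ℝ) * Real.logb 2 (⌊m⌋₊ + 1) = Real.logb 2 ((⌊m⌋₊ + 1) ^ 2) := by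
        rw [Real.logb_pow]; norm_num
      rw [this, hκ]
      refine Real.logb_le_logb_of_le (by norm_num) (by positivity) ?_
      push_cast
      nlinarith [Nat.cast_nonneg (α := ℝ) κ]
    linarith
  refine ⟨(key (.inl fun _ => 0)).1, fun hmn => ?_, fun hδ => ?_⟩
  · rw [hκ] at hmn key ⊢
    obtain ⟨d, hd1, hd2⟩ := exists_decrementSource (by omega) hmn θ
    have h := (key (.inl d)).2
    have hw : Real.logb 2 (indexWeight n κ (.inl d)) =
        -1 + ∑ l : Fin (κ + 1), Real.logb 2 (geomWeight (decrementScale n l) (d l)) := by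
      have hpos : ∀ l : Fin (κ + 1), 0 < geomWeight (decrementScale n l) (d l) :=
        fun l => geomWeight_pos (le_max_left _ _) _
      rw [indexWeight, Real.logb_mul (by norm_num) (Finset.prod_pos fun l _ => hpos l).ne',
        Real.logb_prod _ _ fun l _ => (hpos l).ne', one_div, Real.logb_inv,
        Real.logb_self_eq_one (by norm_num)]
    rw [hw] at h
    rw [Finset.sum_neg_distrib] at hd1
    simp only [indexSource] at h
    linarith
  · rw [hκ] at key ⊢
    obtain ⟨b, hb⟩ := exists_levelSource (k := κ + 1) (J := levelCount n (κ + 1)) (n := n)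
      (by omega) (by omega) hstep hδ (by
        have := Nat.le_ceil (Real.log (((κ + 1 : ℕ) : ℝ) * n) / levelStep n)
        rw [div_le_iff₀' hstep] at this
        exact this) θ
    have h := (key (.inr b)).2
    have hw : Real.logb 2 (indexWeight n κ (.inr b)) =
        -1 - levelCount n (κ + 1) * Real.logb 2 ((κ + 1 : ℕ) + 1) := by
      rw [indexWeight, Real.logb_mul (by norm_num) (by positivity), one_div, Real.logb_inv,
        Real.logb_self_eq_one (by norm_num), one_div, Real.logb_inv, Real.logb_pow]
      push_cast
      ring
    rw [hw] at h
    simp only [indexSource] at h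
    linarith

/-! ### Asymptotics of the cost of the universal code -/

theorem one_le_logb_two_natCast {n : ℕ} (hn : 2 ≤ n) : 1 ≤ Real.logb 2 (n : ℝ) := by
  rw [← Real.logb_self_eq_one (b := 2) (by norm_num)]
  exact Real.logb_le_logb_of_le (by norm_num) (by norm_num) (by exact_mod_cast hn)

theorem rpow_one_third_pow_three (n : ℕ) : ((n : ℝ) ^ ((1 : ℝ) / 3)) ^ 3 = n := by
  rw [← Real.rpow_natCast, ← Real.rpow_mul (by positivity)]
  norm_num

/-- With `x = log m + log n`, `s = √(log n)` and `N = n^{1/3}`, the positions cost about `x² N/s`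
and the divergence is of order `s³ N/s`, no larger because `s² ≤ x`. The lower-order terms are
absorbed since `x` and `N/s` are at least 1. -/
theorem level_cost_le {n : ℕ} (hn : 2 ≤ n) {m : ℝ} (hm : 1 ≤ m)
    (hs : √(Real.logb 2 n) ≤ (n : ℝ) ^ ((1 : ℝ) / 3)) :
    levelStep n ≤ 1 ∧
      (levelCount n ⌊m⌋₊ + 2) * Real.logb 2 (⌊m⌋₊ + 1) + 6 * (n * levelStep n ^ 2) + 9 ≤
        19 * ((Real.logb 2 m + Real.logb 2 n) ^ 2 *
          ((n : ℝ) ^ ((1 : ℝ) / 3) / √(Real.logb 2 n))) := by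
  have hL := one_le_logb_two_natCast hn
  have hn0 : (0 : ℝ) < n := by positivity
  have hk : 1 ≤ ⌊m⌋₊ := Nat.one_le_floor_iff _ |>.2 hm
  have hk1 : (1 : ℝ) ≤ ⌊m⌋₊ := by exact_mod_cast hk
  have hkm : (⌊m⌋₊ : ℝ) ≤ m := Nat.floor_le (by linarith)
  have hN3 := rpow_one_third_pow_three n
  have hs2 := Real.sq_sqrt (show 0 ≤ Real.logb 2 (n : ℝ) by linarith)
  have hs1 : 1 ≤ √(Real.logb 2 (n : ℝ)) := Real.one_le_sqrt.2 hL
  have hM : 0 ≤ Real.logb 2 m := Real.logb_nonneg (by norm_num) hm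
  set N := (n : ℝ) ^ ((1 : ℝ) / 3)
  set s := √(Real.logb 2 (n : ℝ))
  have hN0 : 0 < N := by linarith
  have hδ : levelStep n = s / N := rfl
  set x := Real.logb 2 m + Real.logb 2 n with hx
  have hxs : s ^ 2 ≤ x := by linarith
  refine ⟨by rw [hδ, div_le_one hN0]; exact hs, ?_⟩
  have hlogk : Real.logb 2 (⌊m⌋₊ + 1) ≤ x := by
    have h1 : Real.logb 2 (⌊m⌋₊ + 1) ≤ Real.logb 2 (2 * m) :=
      Real.logb_le_logb_of_le (by norm_num) (by positivity) (by linarith)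
    rw [Real.logb_mul (by norm_num) (by linarith), Real.logb_self_eq_one (by norm_num)] at h1
    linarith
  have hlogk0 : 0 ≤ Real.logb 2 ((⌊m⌋₊ : ℝ) + 1) := Real.logb_nonneg (by norm_num) (by linarith)
  have hlogkn : Real.log (⌊m⌋₊ * n) ≤ x := by
    have h1 : Real.log (⌊m⌋₊ * n) ≤ Real.log (m * n) :=
      Real.log_le_log (by positivity) (mul_le_mul_of_nonneg_right hkm hn0.le)
    have h2 : Real.logb 2 (m * n) = x := Real.logb_mul (by linarith) hn0.ne'
    have h3 : Real.log (m * n) ≤ Real.logb 2 (m * n) := by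
      rw [Real.logb, le_div_iff₀ (Real.log_pos (by norm_num))]
      have h4 : 0 ≤ Real.log (m * n) := Real.log_nonneg (by
        have : (1 : ℝ) ≤ n := by exact_mod_cast (by omega : 1 ≤ n)
        nlinarith)
      have : Real.log 2 ≤ 1 := by linarith [Real.log_two_lt_d9]
      nlinarith
    linarith
  have hr1 : 1 ≤ N / s := by rw [le_div_iff₀ (by linarith)]; linarith
  have hx1 : 1 ≤ x := by nlinarith
  have hJ : (levelCount n ⌊m⌋₊ : ℝ) ≤ x * (N / s) + 1 := by
    have h0 : Real.log (⌊m⌋₊ * n) / levelStep n ≤ x * (N / s) := by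
      rw [hδ, div_div_eq_mul_div, mul_div_assoc]
      exact mul_le_mul_of_nonneg_right hlogkn (by linarith)
    have h1 : 0 ≤ Real.log (⌊m⌋₊ * n) / levelStep n := by
      rw [hδ]
      refine div_nonneg (Real.log_nonneg ?_) (by positivity)
      have : (1 : ℝ) ≤ n := by exact_mod_cast (by omega : 1 ≤ n)
      nlinarith
    have := Nat.ceil_lt_add_one h1
    rw [levelCount]
    linarith
  have h1 : (levelCount n ⌊m⌋₊ + 2) * Real.logb 2 (⌊m⌋₊ + 1) ≤ (x * (N / s) + 1 + 2) * x :=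
    mul_le_mul (by linarith) hlogk hlogk0 (by positivity)
  have h2 : n * levelStep n ^ 2 = s ^ 3 * (N / s) := by
    rw [hδ, ← hN3]
    field_simp
  have h3 : s ^ 3 ≤ x ^ 2 := by
    have : s ^ 3 ≤ s ^ 4 := pow_le_pow_right₀ hs1 (by norm_num)
    nlinarith
  have h4 : s ^ 3 * (N / s) ≤ x ^ 2 * (N / s) := mul_le_mul_of_nonneg_right h3 (by linarith)
  have h5 : x ≤ x ^ 2 * (N / s) := by
    have : x * 1 ≤ x * (x * (N / s)) :=
      mul_le_mul_of_nonneg_left (by nlinarith) (by linarith)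
    nlinarith
  rw [h2]
  nlinarith

/-- Since `m ≤ 2⌊m⌋`, passing from `⌊m⌋` to `m` changes the logarithm by at most 3 bits, an `O(m)`
loss. -/
theorem decrement_cost_le {n : ℕ} (hn : 1 ≤ n) {m : ℝ} (hm : 1 ≤ m)
    (hΛ : 0 ≤ Real.logb 2 ((n : ℝ) / m ^ 3)) :
    ⌊m⌋₊ / 2 * (Real.logb 2 n - 3 * Real.logb 2 ⌊m⌋₊) + 16 * ⌊m⌋₊ +
        2 * Real.logb 2 (⌊m⌋₊ + 1) + 7 ≤
      m / 2 * Real.logb 2 ((n : ℝ) / m ^ 3) + 27 * m := by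
  have hn0 : (0 : ℝ) < n := by positivity
  have hk : 1 ≤ ⌊m⌋₊ := Nat.one_le_floor_iff _ |>.2 hm
  have hk1 : (1 : ℝ) ≤ ⌊m⌋₊ := by exact_mod_cast hk
  have hkm : (⌊m⌋₊ : ℝ) ≤ m := Nat.floor_le (by linarith)
  have hmk : m < ⌊m⌋₊ + 1 := Nat.lt_floor_add_one m
  have hlog : Real.logb 2 ((n : ℝ) / m ^ 3) = Real.logb 2 n - 3 * Real.logb 2 m := by
    rw [Real.logb_div (by positivity) (by positivity), Real.logb_pow]
    norm_num
  have h1 : Real.logb 2 m ≤ 1 + Real.logb 2 ⌊m⌋₊ := by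
    have h := Real.logb_le_logb_of_le (b := 2) (x := m) (y := 2 * ⌊m⌋₊) (by norm_num)
      (by linarith) (by linarith)
    rwa [Real.logb_mul (by norm_num) (by positivity), Real.logb_self_eq_one (by norm_num)] at h
  have h2 : Real.logb 2 (⌊m⌋₊ + 1) ≤ ⌊m⌋₊ := by
    rw [Real.logb_le_iff_le_rpow (by norm_num) (by positivity), Real.rpow_natCast]
    exact_mod_cast Nat.lt_two_pow_self (n := ⌊m⌋₊)
  have h3 : (⌊m⌋₊ : ℝ) / 2 * (Real.logb 2 n - 3 * Real.logb 2 ⌊m⌋₊) ≤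
      m / 2 * (Real.logb 2 ((n : ℝ) / m ^ 3) + 3) := by
    calc (⌊m⌋₊ : ℝ) / 2 * (Real.logb 2 n - 3 * Real.logb 2 ⌊m⌋₊)
        ≤ ⌊m⌋₊ / 2 * (Real.logb 2 ((n : ℝ) / m ^ 3) + 3) :=
          mul_le_mul_of_nonneg_left (by linarith) (by linarith)
      _ ≤ _ := mul_le_mul_of_nonneg_right (by linarith) (by linarith)
  linarith

theorem isLittleO_logb_rpow_one_third :
    (fun n : ℕ => Real.logb 2 (n : ℝ)) =o[atTop] fun n : ℕ => (n : ℝ) ^ ((1 : ℝ) / 3) := by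
  have h := (isLittleO_log_rpow_atTop (r := 1 / 3) (by norm_num)).comp_tendsto
    (tendsto_natCast_atTop_atTop (R := ℝ))
  refine (h.const_mul_left (Real.log 2)⁻¹).congr_left fun n => ?_
  simp only [Function.comp, Real.logb]
  ring

theorem eventually_sqrt_logb_le :
    ∀ᶠ n : ℕ in atTop, √(Real.logb 2 (n : ℝ)) ≤ (n : ℝ) ^ ((1 : ℝ) / 3) := by
  filter_upwards [isLittleO_logb_rpow_one_third.bound one_pos, eventually_ge_atTop 2] with n h hn
  have hL := one_le_logb_two_natCast hn
  rw [one_mul, Real.norm_of_nonneg (by linarith), Real.norm_of_nonneg (by positivity)] at h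
  refine le_trans ?_ h
  rw [Real.sqrt_le_left (by linarith)]
  nlinarith

theorem tendsto_logb_two_natCast : Tendsto (fun n : ℕ => Real.logb 2 (n : ℝ)) atTop atTop :=
  (Real.tendsto_logb_atTop (by norm_num)).comp tendsto_natCast_atTop_atTop

/-- Makes the large-alphabet hypothesis select the second formula in `blockCost`. -/
theorem smallAlphabet_not_large {m : ℕ → ℝ} (hS : SmallAlphabet m) : ¬ LargeAlphabet m := by
  intro hL
  have h := hL.trans_isLittleO hS
  have := (h.bound (show (0 : ℝ) < 1 / 2 by norm_num)).and (eventually_ge_atTop 1)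
  obtain ⟨n, h1, h2⟩ := this.exists
  have h3 : 0 < ‖(n : ℝ) ^ ((1 : ℝ) / 3)‖ := by
    rw [norm_pos_iff]
    have : (0 : ℝ) < n := by positivity
    positivity
  linarith

theorem MonotonicDist.tailTerm_anti (θ : MonotonicDist) {m m' : ℝ} (h : m ≤ m') (i : ℕ+) :
    θ.tailTerm m' i ≤ θ.tailTerm m i := by
  by_cases h' : m' < ((i : ℕ) : ℝ)
  · rw [MonotonicDist.tailTerm, MonotonicDist.tailTerm, if_pos h', if_pos (h.trans_lt h')]
  · have h0 : θ.tailTerm m' i = 0 := by rw [MonotonicDist.tailTerm, if_neg h']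
    rw [h0]
    exact θ.tailTerm_nonneg m i

/-- In the small-alphabet regime the cost of the code is asymptotically the block cost. -/
theorem eventually_small_cost_le {ε : ℝ} (hε : 0 < ε) {m : ℕ → ℝ}
    (hm : ∀ᶠ n : ℕ in atTop, (n : ℝ) ^ ε < m n) (hS : SmallAlphabet m) :
    ∀ᶠ n : ℕ in atTop, ⌊m n⌋₊ ^ 3 ≤ n ∧ 0 ≤ blockCost ε m n ∧
      ⌊m n⌋₊ / 2 * (Real.logb 2 n - 3 * Real.logb 2 ⌊m n⌋₊) + 16 * ⌊m n⌋₊ +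
        2 * Real.logb 2 (⌊m n⌋₊ + 1) + 7 ≤ (1 + ε / 2) * blockCost ε m n := by
  -- Chosen so that `(1 + τ)² ≤ 1 + ε/2`: one factor turns `m` into `m - 1`, the other absorbs the
  -- overhead `27 m`.
  set τ : ℝ := min 1 ε / 6 with hτ
  have hτ0 : 0 < τ := by have : 0 < min 1 ε := lt_min one_pos hε; positivity
  have hτ1 : τ ≤ 1 / 6 := by have := min_le_left 1 ε; linarith
  have hτε : τ ≤ ε / 6 := by have := min_le_right 1 ε; linarith
  have hbig : ∀ᶠ n : ℕ in atTop, 1 + 1 / τ ≤ (n : ℝ) ^ ε :=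
    ((tendsto_rpow_atTop hε).comp tendsto_natCast_atTop_atTop).eventually_ge_atTop _
  -- This little-o constant is what gives `log (n/m³) ≥ 54/τ`.
  filter_upwards [hm, hbig, hS.bound (show (0 : ℝ) < (2 : ℝ) ^ (-(54 / τ) / 3) by positivity),
    eventually_ge_atTop 2] with n h1 h2 h3 hn
  have hτi : 0 < 1 / τ := by positivity
  have hm1 : 1 + 1 / τ ≤ m n := by linarith
  have hm0 : 0 < m n := by linarith
  have hn0 : (0 : ℝ) < n := by positivity
  rw [Real.norm_of_nonneg hm0.le, Real.norm_of_nonneg (by positivity)] at h3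
  have hlogm : Real.logb 2 (m n) ≤ -(54 / τ) / 3 + 1 / 3 * Real.logb 2 n := by
    have := Real.logb_le_logb_of_le (b := 2) (by norm_num) hm0 h3
    rwa [Real.logb_mul (by positivity) (by positivity), Real.logb_rpow (by norm_num) (by norm_num),
      Real.logb_rpow_eq_mul_logb_of_pos hn0] at this
  have hlog : Real.logb 2 ((n : ℝ) / m n ^ 3) = Real.logb 2 n - 3 * Real.logb 2 (m n) := by
    rw [Real.logb_div (by positivity) (by positivity), Real.logb_pow]
    norm_num
  have hΛ : 54 / τ ≤ Real.logb 2 ((n : ℝ) / m n ^ 3) := by rw [hlog]; linarith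
  have hΛ0 : 0 ≤ Real.logb 2 ((n : ℝ) / m n ^ 3) := le_trans (by positivity) hΛ
  have hB : blockCost ε m n = (m n - 1) / 2 * Real.logb 2 ((n : ℝ) / m n ^ 3) := by
    rw [blockCost, if_pos hS]
  have hB0 : 0 ≤ blockCost ε m n := by
    rw [hB]
    exact mul_nonneg (by linarith) hΛ0
  refine ⟨?_, hB0, ?_⟩
  · have h4 : m n ≤ (n : ℝ) ^ ((1 : ℝ) / 3) := by
      refine h3.trans (mul_le_of_le_one_left (by positivity) ?_)
      refine Real.rpow_le_one_of_one_le_of_nonpos (by norm_num) ?_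
      have : 0 < 54 / τ := by positivity
      linarith
    have h5 : (⌊m n⌋₊ : ℝ) ^ 3 ≤ n := by
      rw [← rpow_one_third_pow_three n]
      exact pow_le_pow_left₀ (by positivity) ((Nat.floor_le hm0.le).trans h4) 3
    exact_mod_cast h5
  · refine (decrement_cost_le (by omega) (by linarith) hΛ0).trans ?_
    rw [hB]
    set Λ := Real.logb 2 ((n : ℝ) / m n ^ 3)
    have h4 : 54 ≤ τ * Λ := by rwa [div_le_iff₀' hτ0] at hΛ
    have h5 : m n ≤ (1 + τ) * (m n - 1) := by
      have : 1 ≤ τ * (m n - 1) := by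
        rw [← div_le_iff₀' hτ0]; linarith
      linarith
    have h6 : 27 * m n ≤ m n / 2 * (τ * Λ) := by nlinarith
    have h7 : m n * Λ ≤ (1 + τ) * (m n - 1) * Λ := mul_le_mul_of_nonneg_right h5 hΛ0
    have h8 : (1 + τ) * (1 + τ) ≤ 1 + ε / 2 := by nlinarith
    have h9 : (1 + τ) * (1 + τ) * ((m n - 1) / 2 * Λ) ≤ (1 + ε / 2) * ((m n - 1) / 2 * Λ) :=
      mul_le_mul_of_nonneg_right h8 (by rwa [hB] at hB0)
    have h10 : m n / 2 * Λ + m n / 2 * (τ * Λ) = (1 + τ) / 2 * (m n * Λ) := by ring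
    have h11 : (1 + τ) / 2 * (m n * Λ) ≤ (1 + τ) / 2 * ((1 + τ) * (m n - 1) * Λ) :=
      mul_le_mul_of_nonneg_left h7 (by linarith)
    linarith

/-- In the large-alphabet regime the cost of the code is negligible. -/
theorem eventually_large_cost_le {ε : ℝ} (hε : 0 < ε) {m : ℕ → ℝ}
    (hm : ∀ᶠ n : ℕ in atTop, (n : ℝ) ^ ε < m n) (hL : LargeAlphabet m) :
    ∀ᶠ n : ℕ in atTop, levelStep n ≤ 1 ∧ 0 ≤ blockCost ε m n ∧
      (levelCount n ⌊m n⌋₊ + 2) * Real.logb 2 (⌊m n⌋₊ + 1) + 6 * (n * levelStep n ^ 2) + 9 ≤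
        (1 + ε / 2) * blockCost ε m n := by
  obtain ⟨c, hc0, hc⟩ := hL.exists_pos
  -- Eventually `ρ ≥ 1/3 - ε/2`, where `ρ + ε - 1/3 ≥ c₁ (ρ + 1)`. The block cost is then at least
  -- of order `(ρ + 1)² (log n)² n^{1/3}`, beating the code by `√(log n)`.
  set c₁ : ℝ := ε / (2 * ε + 3) with hc₁
  have hc₁0 : 0 < c₁ := by positivity
  -- The first bound makes the constant `c` cost at most `ε/2` in the exponent; the second yields
  -- `19/√(log n) ≤ c₁/3`.
  have hlog : ∀ᶠ n : ℕ in atTop, max (Real.logb 2 c / (ε / 2)) ((57 / c₁) ^ 2) ≤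
      Real.logb 2 (n : ℝ) := tendsto_logb_two_natCast.eventually_ge_atTop _
  filter_upwards [hm, hc.bound, hlog, eventually_sqrt_logb_le, eventually_ge_atTop 2]
    with n h1 h2 h3 h4 hn
  have hn0 : (0 : ℝ) < n := by positivity
  have hn1 : (1 : ℝ) ≤ n := by exact_mod_cast (by omega : 1 ≤ n)
  have hm1 : 1 ≤ m n := (Real.one_le_rpow hn1 hε.le).trans h1.le
  have hl1 := one_le_logb_two_natCast hn
  obtain ⟨hδ, hcost⟩ := level_cost_le hn hm1 h4
  rw [Real.norm_of_nonneg (by positivity), Real.norm_of_nonneg (by linarith)] at h2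
  have hlogm : 1 / 3 * Real.logb 2 n ≤ Real.logb 2 c + Real.logb 2 (m n) := by
    have := Real.logb_le_logb_of_le (b := 2) (by norm_num) (by positivity) h2
    rwa [Real.logb_mul hc0.ne' (by linarith), Real.logb_rpow_eq_mul_logb_of_pos hn0] at this
  set L := Real.logb 2 (n : ℝ) with hLdef
  set N := (n : ℝ) ^ ((1 : ℝ) / 3) with hN
  have hN0 : 0 < N := by positivity
  set ρ := effExponent (m n) n with hρ
  have hρL : Real.logb 2 (m n) = ρ * L := by
    rw [hρ, effExponent, div_mul_cancel₀ _ (by linarith)]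
  have hρ0 : 0 ≤ ρ := div_nonneg (Real.logb_nonneg (by norm_num) hm1) (by linarith)
  have hc3 : Real.logb 2 c ≤ ε / 2 * L := by
    have := (le_max_left _ _).trans h3
    rwa [div_le_iff₀' (by positivity)] at this
  have hρ1 : 1 / 3 - ε / 2 ≤ ρ := by
    have : (1 / 3 - ε / 2) * L ≤ ρ * L := by linarith
    exact le_of_mul_le_mul_right this (by linarith)
  have hB : blockCost ε m n = 1 / 2 * (ρ + 2 / 3) * (ρ + ε - 1 / 3) * L ^ 2 * N := by
    rw [blockCost, if_neg fun hS => smallAlphabet_not_large hS hL]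
  have hρ2 : c₁ * (ρ + 1) ≤ ρ + ε - 1 / 3 := by
    rw [hc₁, div_mul_eq_mul_div, div_le_iff₀ (by positivity)]
    nlinarith
  have hBge : c₁ / 3 * ((ρ + 1) ^ 2 * L ^ 2 * N) ≤ blockCost ε m n := by
    rw [hB]
    have h5 : 2 / 3 * (ρ + 1) * (c₁ * (ρ + 1)) ≤ (ρ + 2 / 3) * (ρ + ε - 1 / 3) :=
      mul_le_mul (by linarith) hρ2 (by positivity) (by linarith)
    have h6 := mul_le_mul_of_nonneg_right h5 (show 0 ≤ 1 / 2 * (L ^ 2 * N) by positivity)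
    linarith
  have hB0 : 0 ≤ blockCost ε m n := le_trans (by positivity) hBge
  refine ⟨hδ, hB0, hcost.trans ?_⟩
  have hs : 57 / c₁ ≤ √L := Real.le_sqrt_of_sq_le ((le_max_right _ _).trans h3)
  have hs0 : 0 < √L := Real.sqrt_pos.2 (by linarith)
  have hx : (Real.logb 2 (m n) + L) ^ 2 = (ρ + 1) ^ 2 * L ^ 2 := by rw [hρL]; ring
  have h7 : 19 * ((Real.logb 2 (m n) + L) ^ 2 * (N / √L)) ≤
      c₁ / 3 * ((ρ + 1) ^ 2 * L ^ 2 * N) := by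
    rw [hx]
    have h8 : 19 / √L ≤ c₁ / 3 := by
      rw [div_le_iff₀ hs0]
      rw [div_le_iff₀' hc₁0] at hs
      linarith
    have h9 := mul_le_mul_of_nonneg_right h8 (show 0 ≤ (ρ + 1) ^ 2 * L ^ 2 * N by positivity)
    refine le_trans (le_of_eq ?_) h9
    ring
  have h10 : 0 ≤ ε / 2 * blockCost ε m n := by positivity
  linarith

theorem exists_universal_code_sequence :
    ∃ C : (n : ℕ) → BlockCode n, ∀ n, 2 ≤ n → (C n).IsUniversal := by
  suffices h : ∀ n, ∃ C : BlockCode n, 2 ≤ n → C.IsUniversal by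
    choose C hC using h
    exact ⟨C, hC⟩
  intro n
  by_cases hn : 2 ≤ n
  · obtain ⟨C, hC⟩ := exists_universal_code hn
    exact ⟨C, fun _ => hC⟩
  · obtain ⟨C, -⟩ := exists_mixture_code n (ι := Unit) (w := fun _ => 1) (fun _ => one_pos)
      (Summable.of_finite) (by simp) (φ := fun _ => smoothed 2 1 fun _ => 1)
      (fun _ => smoothed_pos le_rfl fun _ => one_pos)
      (fun _ => hasSum_smoothed le_rfl fun _ => one_pos)
    exact ⟨C, fun h => absurd h hn⟩

theorem theorem5 :
    -- Part I
    (∀ ε : ℝ, 0 < ε →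
      ∃ C : (n : ℕ) → BlockCode n,
        ∀ (θ : ℕ → MonotonicDist) (m : ℕ → ℝ),
          (∀ᶠ n : ℕ in atTop, (n : ℝ) ^ ε < m n) →
          (SmallAlphabet m ∨ LargeAlphabet m) →
          (∀ᶠ n : ℕ in atTop, Summable ((θ n).tailTerm (m n))) →
          (fun n : ℕ => (n : ℝ) * (θ n).tailCost (m n)) =o[atTop] blockCost ε m →
          ∀ᶠ n : ℕ in atTop,
            FiniteRedundancy (C n) (θ n) ∧
              redundancy (C n) (θ n) ≤ (1 + ε) / (n : ℝ) * blockCost ε m n) ∧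
    -- Part II
    (∃ C : (n : ℕ) → BlockCode n,
      ∀ (θ : ℕ → MonotonicDist) (m : ℕ → ℝ),
        (∀ᶠ n : ℕ in atTop, 1 ≤ m n) →
        (fun n : ℕ => effExponent (m n) n)
          =o[atTop] (fun n : ℕ => (n : ℝ) ^ ((1 : ℝ) / 3) / Real.logb 2 (n : ℝ)) →
        (∀ᶠ n : ℕ in atTop, Summable ((θ n).tailTerm (m n))) →
        Tendsto (fun n : ℕ => (θ n).tailCost (m n)) atTop (nhds 0) →
        (∀ᶠ n : ℕ in atTop, FiniteRedundancy (C n) (θ n)) ∧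
          Tendsto (fun n : ℕ => redundancy (C n) (θ n)) atTop (nhds 0)) := by
  obtain ⟨C, hC⟩ := exists_universal_code_sequence
  refine ⟨fun ε hε => ⟨C, fun θ m hm hSL hs ho => ?_⟩, C, fun θ m hm hρ hs hT => ?_⟩
  · have hη : 0 < ε / 2 / (1 / ε + 3) := by positivity
    have hgen : ∀ᶠ n : ℕ in atTop, 2 ≤ n ∧ 1 ≤ m n ∧
        Real.logb 2 n ≤ 1 / ε * Real.logb 2 (m n) := by
      filter_upwards [hm, eventually_ge_atTop 2] with n h1 hn
      have hn0 : (0 : ℝ) < n := by positivity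
      have hn1 : (1 : ℝ) ≤ n := by exact_mod_cast (by omega : 1 ≤ n)
      refine ⟨hn, (Real.one_le_rpow hn1 hε.le).trans h1.le, ?_⟩
      have := Real.logb_le_logb_of_le (b := 2) (by norm_num) (by positivity) h1.le
      rw [Real.logb_rpow_eq_mul_logb_of_pos hn0] at this
      rw [one_div, ← div_eq_inv_mul, le_div_iff₀' hε]
      exact this
    have hfin : ∀ n : ℕ, 2 ≤ n → ∀ R : ℝ, 0 ≤ blockCost ε m n →
        R ≤ (1 + ε / 2) * blockCost ε m n →
        ‖(n : ℝ) * (θ n).tailCost (m n)‖ ≤ ε / 2 / (1 / ε + 3) * ‖blockCost ε m n‖ →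
        n * redundancy (C n) (θ n) ≤ R + (1 / ε + 3) * (n * (θ n).tailCost (m n)) →
        redundancy (C n) (θ n) ≤ (1 + ε) / (n : ℝ) * blockCost ε m n := by
      intro n hn R hB0 hR ht hr
      have hn0 : (0 : ℝ) < n := by positivity
      rw [Real.norm_of_nonneg hB0] at ht
      have h1 := mul_le_mul_of_nonneg_left ((le_abs_self _).trans ht)
        (show 0 ≤ 1 / ε + 3 by positivity)
      rw [← mul_assoc _ (_ / _), mul_div_cancel₀ _ (by positivity : 1 / ε + 3 ≠ 0)] at h1
      rw [div_mul_eq_mul_div, le_div_iff₀' hn0]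
      linarith
    rcases hSL with hS | hL
    · filter_upwards [hgen, hs, ho.bound hη, eventually_small_cost_le hε hm hS]
        with n ⟨hn, hm1, hK⟩ hsn ht ⟨h3, hB0, hcost⟩
      obtain ⟨hF, hsmall, -⟩ := (hC n hn).2 (θ n) (m n) (1 / ε) hm1 hK hsn
      exact ⟨hF, hfin n hn _ hB0 hcost ht (hsmall h3)⟩
    · filter_upwards [hgen, hs, ho.bound hη, eventually_large_cost_le hε hm hL]
        with n ⟨hn, hm1, hK⟩ hsn ht ⟨h3, hB0, hcost⟩
      obtain ⟨hF, -, hlarge⟩ := (hC n hn).2 (θ n) (m n) (1 / ε) hm1 hK hsn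
      exact ⟨hF, hfin n hn _ hB0 hcost ht (hlarge h3)⟩
  · have hlogm : (fun n : ℕ => Real.logb 2 (m n)) =o[atTop]
        fun n : ℕ => (n : ℝ) ^ ((1 : ℝ) / 3) := by
      have h := hρ.mul_isBigO (isBigO_refl (fun n : ℕ => Real.logb 2 (n : ℝ)) atTop)
      refine h.congr' ?_ ?_ <;> filter_upwards [eventually_ge_atTop 2] with n hn <;>
        have hl := one_le_logb_two_natCast hn
      · rw [effExponent, div_mul_cancel₀ _ (by linarith)]
      · rw [div_mul_cancel₀ _ (by linarith)]
    have hx : Tendsto (fun n : ℕ => (Real.logb 2 (m n) + 2 * Real.logb 2 n) /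
        (n : ℝ) ^ ((1 : ℝ) / 3)) atTop (nhds 0) :=
      (hlogm.add (isLittleO_logb_rpow_one_third.const_mul_left 2)).tendsto_div_nhds_zero
    have hub : Tendsto (fun n : ℕ => 19 * ((Real.logb 2 (m n) + 2 * Real.logb 2 n) /
        (n : ℝ) ^ ((1 : ℝ) / 3)) ^ 2 + 4 * (θ n).tailCost (m n)) atTop (nhds 0) := by
      simpa using ((hx.pow 2).const_mul 19).add (hT.const_mul 4)
    have hmain : ∀ᶠ n : ℕ in atTop, FiniteRedundancy (C n) (θ n) ∧
        0 ≤ redundancy (C n) (θ n) ∧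
        redundancy (C n) (θ n) ≤ 19 * ((Real.logb 2 (m n) + 2 * Real.logb 2 n) /
          (n : ℝ) ^ ((1 : ℝ) / 3)) ^ 2 + 4 * (θ n).tailCost (m n) := by
      filter_upwards [hm, hs, eventually_sqrt_logb_le, eventually_ge_atTop 2] with n hm1 hsn hsq hn
      have hn0 : (0 : ℝ) < n := by positivity
      have hn1 : (1 : ℝ) ≤ n := by exact_mod_cast (by omega : 1 ≤ n)
      have hl := one_le_logb_two_natCast hn
      have hM0 : 0 ≤ Real.logb 2 (m n) := Real.logb_nonneg (by norm_num) hm1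
      -- Enlarging `m` to at least `n` allows `K = 1` without a lower bound on `m`. The tail only
      -- shrinks, and `log m` grows by at most `log n`.
      set m' := max (m n) n with hm'
      have hm'1 : 1 ≤ m' := hm1.trans (le_max_left _ _)
      have hlog1 : Real.logb 2 (n : ℝ) ≤ Real.logb 2 m' :=
        Real.logb_le_logb_of_le (by norm_num) hn0 (le_max_right _ _)
      have hlog2 : Real.logb 2 m' ≤ Real.logb 2 (m n) + Real.logb 2 n := by
        rw [← Real.logb_mul (by linarith) hn0.ne']
        refine Real.logb_le_logb_of_le (by norm_num) (by linarith) (max_le ?_ ?_) <;> nlinarith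
      have hle := (θ n).tailTerm_anti (le_max_left (m n) (n : ℝ))
      have hs' : Summable ((θ n).tailTerm m') :=
        hsn.of_nonneg_of_le ((θ n).tailTerm_nonneg m') hle
      have hT' : (θ n).tailCost m' ≤ (θ n).tailCost (m n) := hs'.tsum_le_tsum hle hsn
      obtain ⟨hK, hCn⟩ := hC n hn
      obtain ⟨hF, -, hlarge⟩ := hCn (θ n) m' 1 hm'1 (by linarith) hs'
      obtain ⟨hδ, hcost⟩ := level_cost_le hn hm'1 hsq
      refine ⟨hF, redundancy_nonneg (by omega) hK hF, ?_⟩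
      have hr := hlarge hδ
      have hN3 := rpow_one_third_pow_three n
      have hs1 : 1 ≤ √(Real.logb 2 (n : ℝ)) := Real.one_le_sqrt.2 hl
      set N := (n : ℝ) ^ ((1 : ℝ) / 3) with hN
      have hN0 : 0 < N := by positivity
      have h1 : (Real.logb 2 m' + Real.logb 2 n) ^ 2 * (N / √(Real.logb 2 (n : ℝ))) ≤
          (Real.logb 2 (m n) + 2 * Real.logb 2 n) ^ 2 * N :=
        mul_le_mul (pow_le_pow_left₀ (by linarith) (by linarith) 2)
          (div_le_self hN0.le hs1) (by positivity) (by positivity)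
      have h2 : (Real.logb 2 (m n) + 2 * Real.logb 2 n) ^ 2 * N =
          n * ((Real.logb 2 (m n) + 2 * Real.logb 2 n) / N) ^ 2 := by
        rw [← hN3]
        field_simp
      have h3 : n * redundancy (C n) (θ n) ≤
          n * (19 * ((Real.logb 2 (m n) + 2 * Real.logb 2 n) / N) ^ 2 +
            4 * (θ n).tailCost (m n)) := by
        have h4 := mul_le_mul_of_nonneg_left hT' hn0.le
        linarith
      exact le_of_mul_le_mul_left h3 hn0
    refine ⟨hmain.mono fun n h => h.1, ?_⟩
    exact tendsto_of_tendsto_of_tendsto_of_le_of_le' tendsto_const_nhds hub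
      (hmain.mono fun n h => h.2.1) (hmain.mono fun n h => h.2.2)
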